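/- **Conventions.** A computation graph over a datatype $D$ and a set of primitive functions $D^*\to D$ is a finite directed acyclic graph on the nodes $0,\dots,\mathrm{size}-1$. Each node is either labelled by the symbol $\mathsf{input}$ (and then has no incoming edges) or by a primitive function; the edges into a node are numbered $0,1,2,\dots$ by their argument index. The input nodes, in increasing order, receive the input values, and the last node (or, where stated, the last $k'\ge 1$ nodes) is the output. $\mathrm{depth}$ is the largest number of nodes on a path from an input node to an output node. A threshold circuit is a computation graph over $\{0,1\}$ whose primitive functions are the gates $\theta_{\le\Delta}$ (at most $\Delta$ ones among the arguments) and $\theta_{\ge\Delta}$ (at least $\Delta$ ones). A family $(G_n)_{n\in\mathbb N}$ of computation graphs is log-uniform if $\mathsf{node}(n,i)$ (the type of node $i$ of $G_n$, or $\emptyset$ if $i\ge \mathrm{size}(G_n)$; for all $n,i$) and $\mathsf{edge}(n,i,j)$ (the argument index of $i$ into $j$, or $-1$ if there is no edge; for $i,j<\mathrm{size}(G_n)$) are computable by deterministic multitape Turing machines, on numbers in binary, in time $O(\log n)$. A log-uniform $\mathsf{TC}^0$ family is a log-uniform family of threshold circuits of constant depth and polynomial size. Let $p(n)\ge 1$ and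 let $D_p=\{0,1\}^{p(n)}$ be the datatype at length $n$. **Statement.** Let $\mathcal G=(G_n)$ be a log-uniform, constant-depth family of computation graphs over $D_p$ and a finite set $\mathfrak F$ of node types ($\mathsf{input}\in\mathfrak F$), where $G_n$ has $n$ input nodes and one output node, and every node of type $\mathcal F\ne\mathsf{input}$ in $G_n$ has $\mathrm{arity}_{\mathcal F}(n)$ arguments. Suppose that each $\mathcal F\in\mathfrak F$ is specified by a log-uniform $\mathsf{TC}^0$ family, also called $\mathcal F$, that computes it: its $n$-th circuit has as its input gates exactly its first $p(n)\cdot\mathrm{arity}_{\mathcal F}(n)$ gates, and its last $p(n)$ gates are its output gates (for $\mathsf{input}$, the circuit takes one value in $D_p$ and passes it on). Suppose that $\mathrm{size}_{\mathcal F}(n)=\mathsf{bsize}(n)$ for all $\mathcal F\in\mathfrak F$ and $n$, where $\mathsf{bsize}(n)$ is a power of $2$ computable in time $O(\log n)$, and that $p(n)\cdot a$ is computable from $(n,a)$ in time $O(\log n)$ for those $a$ with $p(n)\cdot a\le\mathsf{bsize}(n)$. Let $C_n$ be the circuit with $\mathrm{size}(G_n)\cdot\mathsf{bsize}(n)$ gates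 that is defined as follows. For a gate $i$ write $i'=\lfloor i/\mathsf{bsize}(n)\rfloor$ and $s_i=i'\cdot\mathsf{bsize}(n)$. * $\mathsf{node}_{\mathcal C}(n,i)=\mathsf{node}_{\mathcal F}(n,i-s_i)$ with $\mathcal F=\mathsf{node}_{\mathcal G}(n,i')$ (and $\emptyset$ if $\mathsf{node}_{\mathcal G}(n,i')=\emptyset$), except that input gates become IDENTITY gates if $\mathcal F\ne\mathsf{input}$. * If $i'=j'$, then $\mathsf{edge}_{\mathcal C}(n,i,j)=\mathsf{edge}_{\mathcal F}(n,i-s_i,j-s_j)$ with $\mathcal F=\mathsf{node}_{\mathcal G}(n,i')$. * If $i'\ne j'$ and $e=\mathsf{edge}_{\mathcal G}(n,i',j')\ge 0$, then with $b_i=i-(s_i+\mathsf{bsize}(n)-p(n))$ and $b_j=j-(s_j+p(n)\cdot e)$ there is an edge from $i$ to $j$ (the only one into the IDENTITY gate $j$, so with argument index $0$) if $0\le b_i=b_j<p(n)$; in all other cases there is none. Then $\mathcal C=(C_n)$ is a log-uniform $\mathsf{TC}^0$ family, where $C_n$ has $p(n)\cdot n$ input gates and its last $p(n)$ gates are its outputs,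 such that for all $n$ 1. $C_n$ and $G_n$ compute the same function $D_p^n\to D_p$; 2. $\mathrm{depth}_{\mathcal C}(n)\le\mathrm{depth}_{\mathcal G}(n)\cdot\max_{\mathcal F\in\mathfrak F}\mathrm{depth}_{\mathcal F}(n)$; 3. $\mathrm{size}_{\mathcal C}(n)\le\mathrm{size}_{\mathcal G}(n)\cdot\max_{\mathcal F\in\mathfrak F}\mathrm{size}_{\mathcal F}(n)$. -/

import Mathlib

/-! ## Deterministic multitape Turing machines -/

/-- A deterministic Turing machine with `a` input tapes, `b` output tapes and finitely many
work tapes, over the tape alphabet `{blank, 0, 1}` (`none` is the blank). In one step it reads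
the symbols under all its heads and either halts (`none`) or changes its state, overwrites each
scanned symbol, and moves each head by at most one cell. -/
structure MultiTapeTM (a b : ℕ) where
  State : Type
  Work : Type
  finState : Finite State
  finWork : Finite Work
  start : State
  trans : State → (Fin a ⊕ Fin b ⊕ Work → Option Bool) →
    Option (State × (Fin a ⊕ Fin b ⊕ Work → Option Bool × Option Turing.Dir))

namespace MultiTapeTM

variable {a b : ℕ}

structure Cfg (M : MultiTapeTM a b) where
  state : M.State
  tape : Fin a ⊕ Fin b ⊕ M.Work → Turing.Tape (Option Bool)

/-- Overwrite the scanned symbol, then move the head (or leave it in place). -/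
def act (T : Turing.Tape (Option Bool)) (s : Option Bool × Option Turing.Dir) :
    Turing.Tape (Option Bool) :=
  match s.2 with
  | none => T.write s.1
  | some d => (T.write s.1).move d

/-- One step; `none` if the machine halts in this configuration. -/
def step (M : MultiTapeTM a b) (c : M.Cfg) : Option M.Cfg :=
  (M.trans c.state (fun k => (c.tape k).head)).map
    (fun r => ⟨r.1, fun k => act (c.tape k) (r.2 k)⟩)

/-- The tape that holds exactly the binary digits of `m`, least significant digit first, with
the head on the first digit. -/
def numTape (m : ℕ) : Turing.Tape (Option Bool) :=
  Turing.Tape.mk₁ (m.bits.map some)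

/-- The initial configuration: the arguments stand on the input tapes, all else is blank. -/
def init (M : MultiTapeTM a b) (x : Fin a → ℕ) : M.Cfg where
  state := M.start
  tape
    | Sum.inl l => numTape (x l)
    | Sum.inr _ => Turing.Tape.mk₁ []

/-- On input `x` the machine halts after at most `T` steps with `y` on the output tapes. -/
def OutputsInTime (M : MultiTapeTM a b) (x : Fin a → ℕ) (y : Fin b → ℕ) (T : ℕ) : Prop :=
  ∃ t ≤ T, ∃ c : M.Cfg,
    (fun o : Option M.Cfg => o.bind M.step)^[t] (some (M.init x)) = some c ∧
    M.step c = none ∧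
    ∀ l, c.tape (Sum.inr (Sum.inl l)) = numTape (y l)

end MultiTapeTM

/-- The function `f` of the arguments `x 0, …, x a` is computable on the domain `dom` by a
deterministic Turing machine in time `O(log n)`, where `n = x 0` is the first argument. -/
def LogTimeComputable {a b : ℕ} (dom : Set (Fin (a + 1) → ℕ))
    (f : (Fin (a + 1) → ℕ) → Fin b → ℕ) : Prop :=
  ∃ (M : MultiTapeTM (a + 1) b) (c : ℕ),
    ∀ x ∈ dom, M.OutputsInTime x (f x) (c * Nat.log 2 (x 0) + c)

/-! ## Computation graphs -/

/-- Node types: the special symbol `input`, or one of the primitive functions. -/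
inductive NodeType (Φ : Type) where
  | input : NodeType Φ
  | prim (f : Φ) : NodeType Φ
  deriving DecidableEq, Fintype

/-- The data of a computation graph on the nodes `0, …, size - 1`: `node i` is the type of node
`i` (`none` if there is no such node), and for `i, j < size`, `edge i j` is the argument index
of `i` into `j` if there is an edge from `i` to `j`, and `none` otherwise. -/
structure CompGraph (Φ : Type) where
  size : ℕ
  node : ℕ → Option (NodeType Φ)
  edge : ℕ → ℕ → Option ℕ

namespace CompGraph

variable {Φ D : Type}

/-- There is an edge from node `i` to node `j`. -/
def Adj (G : CompGraph Φ) (i j : ℕ) : Prop :=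
  i < G.size ∧ j < G.size ∧ (G.edge i j).isSome

def IsInput (G : CompGraph Φ) (i : ℕ) : Prop :=
  G.node i = some NodeType.input

instance (G : CompGraph Φ) : DecidablePred G.IsInput := fun i =>
  match h : G.node i with
  | some NodeType.input => isTrue h
  | some (NodeType.prim _) => isFalse (by simp [IsInput, h])
  | none => isFalse (by simp [IsInput, h])

/-- The number of edges into node `j`. -/
def arity (G : CompGraph Φ) (j : ℕ) : ℕ :=
  ((Finset.range G.size).filter (fun i => (G.edge i j).isSome)).card

/-- The sources of the edges into `j`, in the order of the argument indices. -/
def args (G : CompGraph Φ) (j : ℕ) : List ℕ :=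
  (List.range (G.arity j)).flatMap
    (fun a => (List.range G.size).filter (fun i => G.edge i j = some a))

/-- `G` is a computation graph with `k` input nodes whose last `outs` nodes are its output nodes,
and in which a node of type `f` has `ar f` arguments if `ar f` is specified. -/
structure IsValid (G : CompGraph Φ) (k outs : ℕ) (ar : Φ → Option ℕ) : Prop where
  node_none : ∀ i, G.node i = none ↔ G.size ≤ i
  one_le_outs : 1 ≤ outs
  outs_le : outs ≤ G.size
  acyclic : ∀ i, ¬ Relation.TransGen G.Adj i i
  inputs : Nat.count G.IsInput G.size = k
  input_arity : ∀ j < G.size, G.IsInput j → G.arity j = 0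
  prim_arity : ∀ j < G.size, ∀ f m, G.node j = some (NodeType.prim f) → ar f = some m →
    G.arity j = m
  arg_lt : ∀ i < G.size, ∀ j < G.size, ∀ a, G.edge i j = some a → a < G.arity j
  arg_inj : ∀ i < G.size, ∀ i' < G.size, ∀ j < G.size, ∀ a,
    G.edge i j = some a → G.edge i' j = some a → i = i'

/-- `v` assigns to every node its value on the input `x`: the input nodes, in the order of their
indices, carry the entries of `x`, and every other node carries its primitive function applied
to the values of its arguments. -/
def IsValuation (G : CompGraph Φ) (sem : Φ → List D → D) (x : List D) (v : ℕ → D) : Prop :=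
  ∀ i < G.size,
    (G.IsInput i → x[Nat.count G.IsInput i]? = some (v i)) ∧
    ∀ f, G.node i = some (NodeType.prim f) → v i = sem f ((G.args i).map v)

/-- On the input `x` the last `outs` nodes carry the values `y`. -/
def Outputs (G : CompGraph Φ) (sem : Φ → List D → D) (outs : ℕ) (x y : List D) : Prop :=
  ∃ v, G.IsValuation sem x v ∧
    y = (List.range outs).map (fun t => v (G.size - outs + t))

lemma adj_of_mem_args (G : CompGraph Φ) {i j : ℕ} (hj : j < G.size) (h : i ∈ G.args j) :
    G.Adj i j := by
  simp only [args, List.mem_flatMap, List.mem_filter, List.mem_range, decide_eq_true_eq] at h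
  obtain ⟨a, -, hi, he⟩ := h
  exact ⟨hi, hj, by simp [he]⟩

lemma IsValid.wf {G : CompGraph Φ} {k outs : ℕ} {ar : Φ → Option ℕ}
    (h : G.IsValid k outs ar) : WellFounded G.Adj := by
  have hT : WellFounded (fun i j : Fin G.size => Relation.TransGen G.Adj i.1 j.1) := by
    have : IsTrans (Fin G.size) (fun i j => Relation.TransGen G.Adj i.1 j.1) :=
      ⟨fun _ _ _ h1 h2 => h1.trans h2⟩
    have : Std.Irrefl (fun i j : Fin G.size => Relation.TransGen G.Adj i.1 j.1) :=
      ⟨fun i hi => h.acyclic i.1 hi⟩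
    exact Finite.wellFounded_of_trans_of_irrefl _
  have key : ∀ j : Fin G.size, Acc G.Adj j.1 := fun j => by
    induction j using hT.induction with
    | _ j ih => exact ⟨_, fun i hi => ih ⟨i, hi.1⟩ (Relation.TransGen.single hi)⟩
  exact ⟨fun j => ⟨_, fun i hi => key ⟨i, hi.1⟩⟩⟩

/-- A computation graph computes a function: every input has exactly one output. -/
theorem IsValid.existsUnique_outputs {G : CompGraph Φ} {k outs : ℕ} {ar : Φ → Option ℕ}
    (h : G.IsValid k outs ar) [Inhabited D] (sem : Φ → List D → D) (x : List D)
    (hx : x.length = k) : ∃! y, G.Outputs sem outs x y := by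
  classical
  have hlt : ∀ i < G.size, G.IsInput i → Nat.count G.IsInput i < x.length := by
    intro i hi hin
    rw [hx, ← h.inputs]
    exact Nat.count_strict_mono hin hi
  let body : (j : ℕ) → ((i : ℕ) → G.Adj i j → D) → D := fun j rec =>
    match G.node j with
    | some NodeType.input => (x[Nat.count G.IsInput j]?).getD default
    | some (NodeType.prim f) =>
        sem f ((G.args j).map (fun i => if hi : G.Adj i j then rec i hi else default))
    | none => default
  let v : ℕ → D := h.wf.fix body
  have hv : ∀ j, v j = body j (fun i _ => v i) := fun j => WellFounded.fix_eq _ _ _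
  have hval : G.IsValuation sem x v := by
    intro i hi
    refine ⟨fun hin => ?_, fun f hf => ?_⟩
    · have h1 := hlt i hi hin
      rw [hv i]
      have h2 : G.node i = some NodeType.input := hin
      simp [body, h2, h1]
    · rw [hv i]
      simp only [body, hf]
      congr 1
      apply List.map_congr_left
      intro m hm
      simp [G.adj_of_mem_args hi hm]
  have huniq : ∀ w, G.IsValuation sem x w → ∀ i < G.size, w i = v i := by
    intro w hw i
    induction i using h.wf.induction with
    | _ i ih =>
      intro hi
      cases hn : G.node i with
      | none => exact absurd ((h.node_none i).1 hn) (by omega)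
      | some t =>
        cases t with
        | input =>
          have := ((hw i hi).1 hn).symm.trans ((hval i hi).1 hn)
          simpa using this
        | prim f =>
          rw [(hw i hi).2 f hn, (hval i hi).2 f hn]
          congr 1
          apply List.map_congr_left
          intro m hm
          have := G.adj_of_mem_args hi hm
          exact ih m this this.1
  refine ⟨_, ⟨v, hval, rfl⟩, ?_⟩
  rintro y ⟨w, hw, rfl⟩
  apply List.map_congr_left
  intro t ht
  have h1 := h.outs_le
  have h2 := List.mem_range.1 ht
  exact huniq w hw _ (by omega)

/-- `l` is the list of nodes of a path from an input node to one of the last `outs` nodes. -/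
def IsIOPath (G : CompGraph Φ) (outs : ℕ) (l : List ℕ) : Prop :=
  (∀ i ∈ l, i < G.size) ∧ l.IsChain G.Adj ∧
    (∃ s ∈ l.head?, G.IsInput s) ∧ ∃ t ∈ l.getLast?, G.size ≤ t + outs

/-- The length of the longest path from an input node to an output node, where the length of a
path is the number of its nodes (and `0` if there is no such path). -/
noncomputable def depth (G : CompGraph Φ) (outs : ℕ) : ℕ∞ :=
  ⨆ l ∈ {l : List ℕ | G.IsIOPath outs l}, (l.length : ℕ∞)

end CompGraph

/-! ## Families of computation graphs -/

def ConstantDepth {Φ : Type} (G : ℕ → CompGraph Φ) (outs : ℕ → ℕ) : Prop :=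
  ∃ d : ℕ, ∀ n, (G n).depth (outs n) ≤ d

def PolySize {Φ : Type} (G : ℕ → CompGraph Φ) : Prop :=
  ∃ c k : ℕ, ∀ n, (G n).size ≤ c * n ^ k + c

/-- An argument index, or `-1` if there is no edge, as a natural number. -/
def edgeCode : Option ℕ → ℕ
  | none => 0
  | some a => a + 1

/-- The functions `(n, i) ↦ node` (for all `i`) and `(n, i, j) ↦ edge` (for nodes `i, j`) of the
family are computable in time `O(log n)`; `enc` writes node types as tuples of numbers. -/
def LogUniform {Φ : Type} {b : ℕ} (enc : Option (NodeType Φ) → Fin b → ℕ)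
    (G : ℕ → CompGraph Φ) : Prop :=
  LogTimeComputable (a := 1) Set.univ (fun x => enc ((G (x 0)).node (x 1))) ∧
  LogTimeComputable (a := 2) {x | x 1 < (G (x 0)).size ∧ x 2 < (G (x 0)).size}
    (fun x (_ : Fin 1) => edgeCode ((G (x 0)).edge (x 1) (x 2)))

/-- Encoding of the types from a finite set of node types. -/
def typeCode {q : ℕ} : Option (NodeType (Fin q)) → Fin 1 → ℕ
  | none => ![0]
  | some NodeType.input => ![1]
  | some (NodeType.prim f) => ![f.val + 2]

/-! ## Threshold circuits -/

/-- The threshold gates `θ_{≤ Δ}` and `θ_{≥ Δ}`. -/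
inductive Gate where
  | le (Δ : ℕ) : Gate
  | ge (Δ : ℕ) : Gate

def Gate.eval : Gate → List Bool → Bool
  | Gate.le Δ, x => decide (x.count true ≤ Δ)
  | Gate.ge Δ, x => decide (Δ ≤ x.count true)

/-- Encoding of the gate types: a tag together with the threshold. -/
def gateCode : Option (NodeType Gate) → Fin 2 → ℕ
  | none => ![0, 0]
  | some NodeType.input => ![1, 0]
  | some (NodeType.prim (Gate.le Δ)) => ![2, Δ]
  | some (NodeType.prim (Gate.ge Δ)) => ![3, Δ]

/-- A log-uniform family of threshold circuits of constant depth and polynomial size; the `n`-th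
circuit has `k n` input gates and `outs n` output gates (its last ones). -/
structure IsLogUniformTC0 (C : ℕ → CompGraph Gate) (k outs : ℕ → ℕ) : Prop where
  valid : ∀ n, (C n).IsValid (k n) (outs n) (fun _ => none)
  uniform : LogUniform gateCode C
  constDepth : ConstantDepth C outs
  polySize : PolySize C

/-! ## Simulating a computation graph by a threshold circuit -/

/-- The datatype of `p`-bit values. -/
abbrev Word (p : ℕ) : Type := Fin p → Bool

/-- The concatenation of a sequence of `p`-bit values. -/
def bitsOf {p : ℕ} (x : List (Word p)) : List Bool := x.flatMap List.ofFn

/-- The number of `p`-bit values that the circuit of a node type takes; the circuit of the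
symbol `input` takes one value and passes it on. -/
def blockArity {q : ℕ} (arity : Fin q → ℕ → ℕ) : NodeType (Fin q) → ℕ → ℕ
  | NodeType.input, _ => 1
  | NodeType.prim f, n => arity f n

/-- Every node type is specified by a log-uniform `TC⁰` family over `p n`-bit values, whose input
gates come first: the family `F (prim f)` computes the primitive function `f`, and the family
`F input` computes the identity. -/
structure SpecifiedBy {q : ℕ} (p : ℕ → ℕ) (arity : Fin q → ℕ → ℕ)
    (fn : (n : ℕ) → Fin q → List (Word (p n)) → Word (p n))
    (F : NodeType (Fin q) → ℕ → CompGraph Gate) : Prop where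
  tc0 : ∀ τ, IsLogUniformTC0 (F τ) (fun n => p n * blockArity arity τ n) p
  inputs_first : ∀ τ n i, (F τ n).IsInput i ↔ i < p n * blockArity arity τ n
  input : ∀ n (w : Word (p n)),
    (F NodeType.input n).Outputs Gate.eval (p n) (bitsOf [w]) (bitsOf [w])
  prim : ∀ f n (x : List (Word (p n))), x.length = arity f n →
    (F (NodeType.prim f) n).Outputs Gate.eval (p n) (bitsOf x) (bitsOf [fn n f x])

/-- A block mapping (for one input length). -/
structure BlockMap where
  bnode : ℕ → ℕ
  bstart : ℕ → ℕ
  bsize : ℕ → ℕ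

/-- The block mapping into consecutive blocks of the common size `s`. If `s` is a power of `2`,
`bnode` and `bstart` are binary shifts. -/
def shiftMap (s : ℕ) : BlockMap where
  bnode i := i / s
  bstart i' := i' * s
  bsize _ := s

/-- The type of a gate of a block: outside the blocks of the input nodes, the gates reserved for
taking input become IDENTITY gates (`θ_{≥ 1}` with one argument). -/
def blockGate {Φ : Type} : NodeType Φ → NodeType Gate → NodeType Gate
  | NodeType.prim _, NodeType.input => NodeType.prim (Gate.ge 1)
  | _, g => g

/-- The type of gate `i` of the simulating circuit. -/
def simNode {Φ : Type} (B : BlockMap) (G : CompGraph Φ) (F : NodeType Φ → CompGraph Gate)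
    (i : ℕ) : Option (NodeType Gate) :=
  let i' := B.bnode i
  match G.node i' with
  | none => none
  | some τ => ((F τ).node (i - B.bstart i')).map (blockGate τ)

/-- The edge from gate `i` to gate `j` in the simulating circuit: inside a block, the edges of the
circuit of the node type; and if node `i'` is the `e`-th argument of node `j'`, then the last `p`
gates of block `i'` feed the gates `p * e, …, p * e + p - 1` of block `j'`, each of which thereby
has one argument. -/
def simEdge {Φ : Type} (B : BlockMap) (p : ℕ) (G : CompGraph Φ) (F : NodeType Φ → CompGraph Gate)
    (i j : ℕ) : Option ℕ :=
  let i' := B.bnode i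
  let j' := B.bnode j
  let si := B.bstart i'
  let sj := B.bstart j'
  if i' = j' then
    match G.node i' with
    | none => none
    | some τ => (F τ).edge (i - si) (j - sj)
  else
    match G.edge i' j' with
    | none => none
    | some e =>
      let bi : ℤ := (i : ℤ) - ((si : ℤ) + B.bsize i' - p)
      let bj : ℤ := (j : ℤ) - ((sj : ℤ) + p * e)
      if 0 ≤ bi ∧ bi = bj ∧ bj < p then some 0 else none

/-- The circuit that simulates `G`, node by node, with blocks of the common size `s`. -/
def simCircuit {Φ : Type} (s p : ℕ) (G : CompGraph Φ) (F : NodeType Φ → CompGraph Gate) :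
    CompGraph Gate where
  size := G.size * s
  node := simNode (shiftMap s) G F
  edge := simEdge (shiftMap s) p G F

/-! The circuit is an explicit substitution, so everything except uniformity is bookkeeping with
gates written as `b * s + u`, `u < s`. An edge either stays inside a block and is an edge of the
circuit of the node type, or it runs along an edge of the graph from an output gate of one block to
an input gate of another (`IsBlockSpec.edge_cases`). Hence paths of the circuit project to paths of
the graph. Cycles are therefore impossible, and a path from an input to an output splits into one
segment per visited node, each leading from an input gate to an output gate of its block circuit;
this gives the product bound on the depth (`exists_split`, `depth_le`). A valuation of the graph and
the valuations of the block circuits on the corresponding arguments glue to a valuation of the whole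
circuit, with the IDENTITY gates copying output bits of the argument blocks (`outputs_of_outputs`).
Uniqueness of outputs turns this into the equivalence `outputs_iff`.

For uniformity, the block size is a power of `2`, so quotient and remainder by it only cut the
binary expansion of a gate number in two. The conditions on `b_i` and `b_j` become one inequality
and one equation between sums of natural numbers, which a finite automaton checks digit by digit
with a bounded carry. Such automata (`Transducer`) are the building blocks. They are combined inside
the class `Computes` of logarithmic-time functions whose programs restore their input; the class is
closed under composition, tupling and case distinction. The only product that occurs, `p * (e + 1)`,
is at most the block size and is thus covered by the hypothesis on `p`.

Two points are less routine. The type of gate `i` must be found in time `O(log n)` for every `i`,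
even if `i` is too long to be read; since the answer is constant beyond a polynomial bound, `i` is
first cut down to `O(log n)` digits (`clip`, `computes_of_clip`). And the graphs are not assumed to
have polynomial size. This follows from log-uniformity (`polySize_of_logUniform`): a machine with
time `O(log n)` cannot distinguish two numbers with equal low digits, whereas `node` must
distinguish nodes from numbers beyond the size. -/

/-! ## Tape programs -/

/-- The tape with `l` to the left of the head (nearest cell first) and `r` from the head on. -/
def tapeOf (l r : List (Option Bool)) : Turing.Tape (Option Bool) :=
  Turing.Tape.mk' (Turing.ListBlank.mk l) (Turing.ListBlank.mk r)

lemma numTape_eq_tapeOf (m : ℕ) :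
    MultiTapeTM.numTape m = tapeOf [] (m.bits.map some) := rfl

lemma tapeOf_head_cons (l r : List (Option Bool)) (s : Option Bool) :
    (tapeOf l (s :: r)).head = s := rfl

/-- Trailing blanks are identified in `Turing.ListBlank`; exposing one gives the write and move
lemmas a cell to act on. -/
lemma tapeOf_nil_eq (l : List (Option Bool)) : tapeOf l [] = tapeOf l [none] := by
  unfold tapeOf
  congr 1
  exact Quotient.sound (Or.inl ⟨1, rfl⟩)

lemma tapeOf_blank_left (r : List (Option Bool)) : tapeOf [none] r = tapeOf [] r := by
  unfold tapeOf
  congr 1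
  exact Quotient.sound (Or.inr ⟨1, rfl⟩)

lemma tapeOf_write (l r : List (Option Bool)) (s t : Option Bool) :
    (tapeOf l (s :: r)).write t = tapeOf l (t :: r) := rfl

lemma tapeOf_move_right (l r : List (Option Bool)) (s : Option Bool) :
    (tapeOf l (s :: r)).move Turing.Dir.right = tapeOf (s :: l) r := by
  simp [tapeOf]

lemma tapeOf_move_left (l r : List (Option Bool)) (s : Option Bool) :
    (tapeOf (s :: l) r).move Turing.Dir.left = tapeOf l (s :: r) := by
  simp [tapeOf]

lemma tapeOf_move_left_nil (r : List (Option Bool)) :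
    (tapeOf [] r).move Turing.Dir.left = tapeOf [] (none :: r) := by
  simp only [tapeOf, Turing.Tape.move_left_mk']
  rfl

/-- A deterministic program that works on tapes indexed by `K`. -/
structure TapeProg (K : Type) where
  State : Type
  finState : Finite State
  start : State
  trans : State → (K → Option Bool) →
    Option (State × (K → Option Bool × Option Turing.Dir))

namespace TapeProg

open MultiTapeTM

variable {K K' : Type}

/-- From state `q` and tapes `T`, the program halts after exactly `t` steps with tapes `T'`. -/
inductive Run (P : TapeProg K) : P.State → (K → Turing.Tape (Option Bool)) →
    (K → Turing.Tape (Option Bool)) → ℕ → Prop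
  | halt {q T} (h : P.trans q (fun k => (T k).head) = none) : Run P q T T 0
  | step {q T r T' t} (h : P.trans q (fun k => (T k).head) = some r)
      (hr : Run P r.1 (fun k => act (T k) (r.2 k)) T' t) : Run P q T T' (t + 1)

/-- From the start state and tapes `T`, the program halts within `t` steps with tapes `T'`. -/
def RunsWithin (P : TapeProg K) (T T' : K → Turing.Tape (Option Bool)) (t : ℕ) : Prop :=
  ∃ s ≤ t, P.Run P.start T T' s

lemma RunsWithin.mono {P : TapeProg K} {T T' : K → Turing.Tape (Option Bool)} {t t' : ℕ}
    (h : P.RunsWithin T T' t) (ht : t ≤ t') : P.RunsWithin T T' t' := by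
  obtain ⟨s, hs, h⟩ := h
  exact ⟨s, hs.trans ht, h⟩

lemma act_stay (T : Turing.Tape (Option Bool)) : act T (T.head, none) = T :=
  Turing.Tape.write_self T

/-- Run `P`, then continue with the program selected by the symbols under the heads. -/
def branch {ι : Type} [Finite ι] (P : TapeProg K) (test : (K → Option Bool) → ι)
    (Q : ι → TapeProg K) : TapeProg K where
  State := P.State ⊕ Σ i, (Q i).State
  finState := by
    have := P.finState
    have := fun i => (Q i).finState
    infer_instance
  start := Sum.inl P.start
  trans
    | Sum.inl s, h =>
      match P.trans s h with
      | none => some (Sum.inr ⟨test h, (Q (test h)).start⟩, fun k => (h k, none))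
      | some r => some (Sum.inl r.1, r.2)
    | Sum.inr s, h => ((Q s.1).trans s.2 h).map (fun r => (Sum.inr ⟨s.1, r.1⟩, r.2))

lemma branch_run_inr {ι : Type} [Finite ι] (P : TapeProg K) (test : (K → Option Bool) → ι)
    (Q : ι → TapeProg K) {i : ι} {q : (Q i).State} {T T' : K → Turing.Tape (Option Bool)} {t : ℕ}
    (h : (Q i).Run q T T' t) : (branch P test Q).Run (Sum.inr ⟨i, q⟩) T T' t := by
  induction h with
  | halt h => exact Run.halt (by simp [branch, h])
  | step h _ ih => exact Run.step (r := (Sum.inr ⟨i, _⟩, _)) (by simp only [branch, h]; rfl) ih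

/-- The additional step is the hand-over: when `P` halts, the scanned symbols are rewritten
unchanged, no head moves, and control passes to the selected program. -/
lemma branch_run_inl {ι : Type} [Finite ι] (P : TapeProg K) (test : (K → Option Bool) → ι)
    (Q : ι → TapeProg K) {q : P.State} {T T' T'' : K → Turing.Tape (Option Bool)} {t t' : ℕ}
    (h : P.Run q T T' t) {i : ι} (hi : test (fun k => (T' k).head) = i)
    (h' : (Q i).Run (Q i).start T' T'' t') :
    (branch P test Q).Run (Sum.inl q) T T'' (t + t' + 1) := by
  induction h with
  | @halt q T h =>
    subst hi
    rw [Nat.zero_add]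
    refine Run.step
      (r := (Sum.inr ⟨test (fun k => (T k).head), (Q (test (fun k => (T k).head))).start⟩,
        fun k => ((T k).head, none)))
      (by simp only [branch, h]) ?_
    simp only [act_stay]
    exact branch_run_inr P test Q h'
  | @step q T r T' t h _ ih =>
    have := ih hi h'
    rw [show t + 1 + t' + 1 = (t + t' + 1) + 1 by ring]
    exact Run.step (r := (Sum.inl r.1, r.2)) (by simp only [branch, h]) this

lemma RunsWithin.branch {ι : Type} [Finite ι] {P : TapeProg K} {test : (K → Option Bool) → ι}
    {Q : ι → TapeProg K} {T T' T'' : K → Turing.Tape (Option Bool)} {t t' : ℕ}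
    (h : P.RunsWithin T T' t) {i : ι} (hi : test (fun k => (T' k).head) = i)
    (h' : (Q i).RunsWithin T' T'' t') :
    (branch P test Q).RunsWithin T T'' (t + t' + 1) := by
  obtain ⟨s, hs, h⟩ := h
  obtain ⟨s', hs', h'⟩ := h'
  exact ⟨s + s' + 1, by omega, branch_run_inl P test Q h hi h'⟩

/-- Run `P`, then `Q`. -/
def seq (P Q : TapeProg K) : TapeProg K := branch P (fun _ => ()) (fun _ => Q)

lemma RunsWithin.seq {P Q : TapeProg K} {T T' T'' : K → Turing.Tape (Option Bool)} {t t' : ℕ}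
    (h : P.RunsWithin T T' t) (h' : Q.RunsWithin T' T'' t') :
    (P.seq Q).RunsWithin T T'' (t + t' + 1) :=
  RunsWithin.branch h rfl h'

open Classical in
/-- Run `P` on the tapes in the range of `e`. -/
noncomputable def embed (e : K → K') (P : TapeProg K) : TapeProg K' where
  State := P.State
  finState := P.finState
  start := P.start
  trans q h := (P.trans q (h ∘ e)).map
    (fun r => (r.1, Function.extend e r.2 (fun k => (h k, none))))

/-- Outside the range of `e` every step rewrites the scanned symbol in place, so those tapes keep
their content; `Function.extend` records both parts of the result at once. -/
lemma embed_run {e : K → K'} (he : Function.Injective e) {P : TapeProg K} {q : P.State}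
    {S S' : K → Turing.Tape (Option Bool)} {t : ℕ} (h : P.Run q S S' t) :
    ∀ T : K' → Turing.Tape (Option Bool), T ∘ e = S →
      (embed e P).Run q T (Function.extend e S' T) t := by
  induction h with
  | @halt q S h =>
    rintro T rfl
    have : Function.extend e (T ∘ e) T = T := by
      funext k
      by_cases hk : ∃ l, e l = k
      · obtain ⟨l, rfl⟩ := hk
        rw [he.extend_apply]; rfl
      · rw [Function.extend_apply' _ _ _ hk]
    rw [this]
    exact Run.halt (by simp only [embed]; erw [h]; rfl)
  | @step q S r S' t h _ ih =>
    rintro T rfl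
    refine Run.step (P := embed e P)
      (r := (r.1, Function.extend e r.2 (fun k : K' => ((T k).head, none)))) ?_ ?_
    · simp only [embed]; erw [h]; rfl
    · have := ih (fun k : K' =>
          act (T k) (Function.extend e r.2 (fun k : K' => ((T k).head, none)) k)) (by
        funext l
        simp [he.extend_apply])
      convert this using 1
      funext k
      by_cases hk : ∃ l, e l = k
      · obtain ⟨l, rfl⟩ := hk
        simp [he.extend_apply]
      · simp only [Function.extend_apply' _ _ _ hk, act_stay]

lemma RunsWithin.embed {e : K → K'} (he : Function.Injective e) {P : TapeProg K}
    {T : K' → Turing.Tape (Option Bool)} {S : K → Turing.Tape (Option Bool)} {t : ℕ}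
    (h : P.RunsWithin (T ∘ e) S t) :
    (embed e P).RunsWithin T (Function.extend e S T) t := by
  obtain ⟨s, hs, h⟩ := h
  exact ⟨s, hs, embed_run he h T rfl⟩

/-- A program on the tapes of a multitape machine, as such a machine. -/
def toTM {a b : ℕ} {W : Type} (hW : Finite W) (P : TapeProg (Fin a ⊕ Fin b ⊕ W)) :
    MultiTapeTM a b where
  State := P.State
  Work := W
  finState := P.finState
  finWork := hW
  start := P.start
  trans := P.trans

/-- A multitape machine, as a program on its tapes. -/
def ofTM {a b : ℕ} (M : MultiTapeTM a b) : TapeProg (Fin a ⊕ Fin b ⊕ M.Work) where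
  State := M.State
  finState := M.finState
  start := M.start
  trans := M.trans

lemma toTM_iterate {a b : ℕ} {W : Type} (hW : Finite W) {P : TapeProg (Fin a ⊕ Fin b ⊕ W)}
    {q : P.State} {T T' : Fin a ⊕ Fin b ⊕ W → Turing.Tape (Option Bool)} {t : ℕ}
    (h : P.Run q T T' t) :
    ∃ c : (P.toTM hW).Cfg,
      (fun o : Option (P.toTM hW).Cfg => o.bind (P.toTM hW).step)^[t] (some ⟨q, T⟩) = some c ∧
      (P.toTM hW).step c = none ∧ c.tape = T' := by
  induction h with
  | @halt q T h =>
    refine ⟨⟨q, T⟩, rfl, ?_, rfl⟩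
    simp only [MultiTapeTM.step, toTM]
    erw [h]; rfl
  | @step q T r T' t h _ ih =>
    obtain ⟨c, h1, h2, h3⟩ := ih
    refine ⟨c, ?_, h2, h3⟩
    rw [Function.iterate_succ_apply, ← h1]
    congr 1
    simp only [Option.bind_some, MultiTapeTM.step, toTM]
    erw [h]; rfl

lemma ofTM_run {a b : ℕ} (M : MultiTapeTM a b) (c' : M.Cfg) : ∀ (t : ℕ) (c : M.Cfg),
    (fun o : Option M.Cfg => o.bind M.step)^[t] (some c) = some c' → M.step c' = none →
      (ofTM M).Run c.state c.tape c'.tape t := by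
  intro t
  induction t with
  | zero =>
    intro c h h'
    obtain rfl : c = c' := by simpa using h
    refine Run.halt ?_
    simp only [MultiTapeTM.step, Option.map_eq_none_iff] at h'
    exact h'
  | succ t ih =>
    intro c h h'
    rw [Function.iterate_succ_apply] at h
    simp only [Option.bind_some] at h
    cases hc : M.step c with
    | none =>
      rw [hc] at h
      -- A machine that has halted too early stays at `none` and cannot reach `c'`.
      have : ∀ s, (fun o : Option M.Cfg => o.bind M.step)^[s] none = none := by
        intro s
        induction s with
        | zero => rfl
        | succ s ih => rw [Function.iterate_succ_apply]; exact ih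
      rw [this] at h
      cases h
    | some d =>
      rw [hc] at h
      have := ih d h h'
      simp only [MultiTapeTM.step, Option.map_eq_some_iff] at hc
      obtain ⟨r, hr, rfl⟩ := hc
      exact Run.step hr this

/-- The tapes with the arguments `x` on the input tapes, all others being blank. -/
def initTapes {a : ℕ} {W : Type} (x : Fin a → ℕ) : Fin a ⊕ W → Turing.Tape (Option Bool)
  | Sum.inl l => numTape (x l)
  | Sum.inr _ => numTape 0

end TapeProg

/-! ### Logarithmic-time computability and its closure properties -/

open TapeProg MultiTapeTM

/-- A machine that maps `f x` to `g x` for `x ∈ D`, in time `O(log (n x))`. -/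
def TMComputes {X : Type} {a b : ℕ} (D : Set X) (n : X → ℕ) (f : X → Fin a → ℕ)
    (g : X → Fin b → ℕ) : Prop :=
  ∃ (M : MultiTapeTM a b) (c : ℕ), ∀ x ∈ D,
    M.OutputsInTime (f x) (g x) (c * (Nat.log 2 (n x) + 1))

/-- A program that maps `f x` to `g x` for `x ∈ D`, in time `O(log (n x))`, and that leaves the
input unchanged. -/
def Computes {X : Type} {a b : ℕ} (D : Set X) (n : X → ℕ) (f : X → Fin a → ℕ)
    (g : X → Fin b → ℕ) : Prop :=
  ∃ (W : Type) (_ : Finite W) (P : TapeProg (Fin a ⊕ Fin b ⊕ W)) (c : ℕ), ∀ x ∈ D, ∃ T,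
    P.RunsWithin (initTapes (f x)) T (c * (Nat.log 2 (n x) + 1)) ∧
    (∀ l, T (Sum.inl l) = numTape (f x l)) ∧ ∀ l, T (Sum.inr (Sum.inl l)) = numTape (g x l)

lemma Computes.tmComputes {X : Type} {a b : ℕ} {D : Set X} {n : X → ℕ} {f : X → Fin a → ℕ}
    {g : X → Fin b → ℕ} (h : Computes D n f g) : TMComputes D n f g := by
  obtain ⟨W, hW, P, c, h⟩ := h
  refine ⟨P.toTM hW, c, fun x hx => ?_⟩
  obtain ⟨T, ⟨t, ht, h1⟩, -, h2⟩ := h x hx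
  obtain ⟨d, hd, hs, rfl⟩ := toTM_iterate hW h1
  refine ⟨t, ht, d, ?_, hs, h2⟩
  rw [← hd]
  congr 2
  simp only [MultiTapeTM.init]
  congr 1
  funext k
  rcases k with k | k <;> rfl

/-- The time bounds agree by definition, as `c * (L + 1)` unfolds to `c * L + c`. Arguments are
indexed by `X` so that machines can be applied to computed values while `n` still measures time. -/
lemma TMComputes.of_logTimeComputable {X : Type} {a b : ℕ} {dom : Set (Fin (a + 1) → ℕ)}
    {F : (Fin (a + 1) → ℕ) → Fin b → ℕ} (h : LogTimeComputable dom F) {D : Set X} {n : X → ℕ}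
    {f : X → Fin (a + 1) → ℕ} (hf : ∀ x ∈ D, f x ∈ dom ∧ f x 0 = n x) :
    TMComputes D n f (fun x => F (f x)) := by
  obtain ⟨M, c, h⟩ := h
  refine ⟨M, c, fun x hx => ?_⟩
  have := h (f x) (hf x hx).1
  rwa [(hf x hx).2] at this

lemma TMComputes.logTimeComputable {a b : ℕ} {dom : Set (Fin (a + 1) → ℕ)}
    {F : (Fin (a + 1) → ℕ) → Fin b → ℕ} (h : TMComputes dom (fun x => x 0) (fun x => x) F) :
    LogTimeComputable dom F := by
  obtain ⟨M, c, h⟩ := h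
  exact ⟨M, c, fun x hx => h x hx⟩

lemma TMComputes.exists_run {X : Type} {a b : ℕ} {D : Set X} {n : X → ℕ} {f : X → Fin a → ℕ}
    {g : X → Fin b → ℕ} (h : TMComputes D n f g) :
    ∃ (W : Type) (_ : Finite W) (P : TapeProg (Fin a ⊕ Fin b ⊕ W)) (c : ℕ), ∀ x ∈ D, ∃ T,
      P.RunsWithin (initTapes (f x)) T (c * (Nat.log 2 (n x) + 1)) ∧
      ∀ l, T (Sum.inr (Sum.inl l)) = numTape (g x l) := by
  obtain ⟨M, c, h⟩ := h
  refine ⟨M.Work, M.finWork, ofTM M, c, fun x hx => ?_⟩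
  obtain ⟨t, ht, d, h1, h2, h3⟩ := h x hx
  refine ⟨d.tape, ⟨t, ht, ?_⟩, h3⟩
  have := ofTM_run M d t _ h1 h2
  have key : (M.init (f x)).tape = initTapes (f x) := by
    funext k
    rcases k with k | k <;> rfl
  rwa [key] at this

/-- The output tapes of the first program serve directly as input tapes of the second, since both
hold digits with the head on the first one. The second program may destroy them, so `TMComputes`
suffices for it; the original input tapes are out of its reach. -/
lemma Computes.comp {X : Type} {a b b' : ℕ} {D : Set X} {n : X → ℕ} {f : X → Fin a → ℕ}
    {g : X → Fin b → ℕ} {h : X → Fin b' → ℕ} (hg : Computes D n f g) (hh : TMComputes D n g h) :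
    Computes D n f h := by
  obtain ⟨W, hW, P, c, hP⟩ := hg
  obtain ⟨W', hW', Q, c', hQ⟩ := hh.exists_run
  let e : Fin a ⊕ Fin b ⊕ W → Fin a ⊕ Fin b' ⊕ (Fin b ⊕ W ⊕ W')
    | Sum.inl l => Sum.inl l
    | Sum.inr (Sum.inl l) => Sum.inr (Sum.inr (Sum.inl l))
    | Sum.inr (Sum.inr w) => Sum.inr (Sum.inr (Sum.inr (Sum.inl w)))
  let e' : Fin b ⊕ Fin b' ⊕ W' → Fin a ⊕ Fin b' ⊕ (Fin b ⊕ W ⊕ W')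
    | Sum.inl l => Sum.inr (Sum.inr (Sum.inl l))
    | Sum.inr (Sum.inl l) => Sum.inr (Sum.inl l)
    | Sum.inr (Sum.inr w) => Sum.inr (Sum.inr (Sum.inr (Sum.inr w)))
  have he : Function.Injective e := by
    rintro (x | x | x) (y | y | y) hxy <;> simp_all [e]
  have he' : Function.Injective e' := by
    rintro (x | x | x) (y | y | y) hxy <;> simp_all [e']
  refine ⟨Fin b ⊕ W ⊕ W', inferInstance, (P.embed e).seq (Q.embed e'), c + c' + 1,
    fun x hx => ?_⟩
  obtain ⟨T, hT, hT1, hT2⟩ := hP x hx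
  obtain ⟨S, hS, hS2⟩ := hQ x hx
  have key1 : initTapes (W := Fin b' ⊕ (Fin b ⊕ W ⊕ W')) (f x) ∘ e = initTapes (f x) := by
    funext k; rcases k with k | k | k <;> rfl
  rw [← key1] at hT
  have r1 := hT.embed he
  set T1 := Function.extend e T (initTapes (W := Fin b' ⊕ (Fin b ⊕ W ⊕ W')) (f x)) with hT1def
  have v1 : ∀ k, T1 (e k) = T k := fun k => he.extend_apply _ _ _
  have v2 : ∀ k, (¬ ∃ l, e l = k) → T1 k = initTapes (f x) k :=
    fun k hk => Function.extend_apply' _ _ _ hk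
  have key2 : T1 ∘ e' = initTapes (g x) := by
    funext k
    rcases k with k | k | k
    · exact (v1 (Sum.inr (Sum.inl k))).trans (hT2 k)
    · refine (v2 _ ?_).trans rfl
      rintro ⟨(l | l | l), hl⟩ <;> simp [e, e'] at hl
    · refine (v2 _ ?_).trans rfl
      rintro ⟨(l | l | l), hl⟩ <;> simp [e, e'] at hl
  rw [← key2] at hS
  have r2 := hS.embed he'
  refine ⟨_, (r1.seq r2).mono ?_, fun l => ?_, fun l => ?_⟩
  · nlinarith [Nat.zero_le (Nat.log 2 (n x))]
  · rw [Function.extend_apply']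
    · exact (v1 (Sum.inl l)).trans (hT1 l)
    · rintro ⟨(l | l | l), hl⟩ <;> simp [e'] at hl
  · exact (he'.extend_apply S T1 (Sum.inr (Sum.inl l))).trans (hS2 l)

/-- Both programs read the same input tapes, which is possible because the first one restores them;
their output and work tapes are disjoint. -/
lemma Computes.cons {X : Type} {a b : ℕ} {D : Set X} {n : X → ℕ} {f : X → Fin a → ℕ}
    {g : X → ℕ} {h : X → Fin b → ℕ} (hg : Computes D n f (fun x => ![g x]))
    (hh : Computes D n f h) :
    Computes D n f (fun x => Matrix.vecCons (g x) (h x)) := by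
  obtain ⟨W, hW, P, c, hP⟩ := hg
  obtain ⟨W', hW', Q, c', hQ⟩ := hh
  let e : Fin a ⊕ Fin 1 ⊕ W → Fin a ⊕ Fin (b + 1) ⊕ (W ⊕ W')
    | Sum.inl l => Sum.inl l
    | Sum.inr (Sum.inl _) => Sum.inr (Sum.inl 0)
    | Sum.inr (Sum.inr w) => Sum.inr (Sum.inr (Sum.inl w))
  let e' : Fin a ⊕ Fin b ⊕ W' → Fin a ⊕ Fin (b + 1) ⊕ (W ⊕ W')
    | Sum.inl l => Sum.inl l
    | Sum.inr (Sum.inl l) => Sum.inr (Sum.inl l.succ)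
    | Sum.inr (Sum.inr w) => Sum.inr (Sum.inr (Sum.inr w))
  have he : Function.Injective e := by
    rintro (x | x | x) (y | y | y) hxy <;> simp_all [e]
    exact Subsingleton.elim _ _
  have he' : Function.Injective e' := by
    rintro (x | x | x) (y | y | y) hxy <;> simp_all [e']
  refine ⟨W ⊕ W', inferInstance, (P.embed e).seq (Q.embed e'), c + c' + 1, fun x hx => ?_⟩
  obtain ⟨T, hT, hT1, hT2⟩ := hP x hx
  obtain ⟨S, hS, hS1, hS2⟩ := hQ x hx
  have key1 : initTapes (W := Fin (b + 1) ⊕ (W ⊕ W')) (f x) ∘ e = initTapes (f x) := by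
    funext k; rcases k with k | k | k <;> rfl
  rw [← key1] at hT
  have r1 := hT.embed he
  set T1 := Function.extend e T (initTapes (W := Fin (b + 1) ⊕ (W ⊕ W')) (f x)) with hT1def
  have v1 : ∀ k, T1 (e k) = T k := fun k => he.extend_apply _ _ _
  have v2 : ∀ k, (¬ ∃ l, e l = k) → T1 k = initTapes (f x) k :=
    fun k hk => Function.extend_apply' _ _ _ hk
  have key2 : T1 ∘ e' = initTapes (f x) := by
    funext k
    rcases k with k | k | k
    · exact (v1 (Sum.inl k)).trans (hT1 k)
    · refine (v2 _ ?_).trans rfl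
      rintro ⟨(l | l | l), hl⟩ <;> simp [e, e'] at hl
      exact Fin.succ_ne_zero _ hl.symm
    · refine (v2 _ ?_).trans rfl
      rintro ⟨(l | l | l), hl⟩ <;> simp [e, e'] at hl
  rw [← key2] at hS
  have r2 := hS.embed he'
  refine ⟨_, (r1.seq r2).mono ?_, fun l => ?_, fun l => ?_⟩
  · nlinarith [Nat.zero_le (Nat.log 2 (n x))]
  · exact (he'.extend_apply S T1 (Sum.inl l)).trans (hS1 l)
  · refine Fin.cases ?_ (fun l => ?_) l
    · rw [Function.extend_apply']
      · exact (v1 (Sum.inr (Sum.inl 0))).trans (hT2 0)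
      · rintro ⟨(l | l | l), hl⟩ <;> simp [e'] at hl
    · exact (he'.extend_apply S T1 (Sum.inr (Sum.inl l))).trans (hS2 l)

/-- Each branch has to work only where it is selected. This permits calling machines that are
correct only on a restricted domain. -/
lemma Computes.ite {X : Type} {a b : ℕ} {D : Set X} {n : X → ℕ} {f : X → Fin a → ℕ}
    {h : X → ℕ} {g₀ g₁ : X → Fin b → ℕ} (hh : Computes D n f (fun x => ![h x]))
    (h₀ : Computes {x ∈ D | h x = 0} n f g₀) (h₁ : Computes {x ∈ D | h x ≠ 0} n f g₁) :
    Computes D n f (fun x => if h x = 0 then g₀ x else g₁ x) := by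
  obtain ⟨W, hW, P, c, hP⟩ := hh
  obtain ⟨W₀, hW₀, Q₀, c₀, hQ₀⟩ := h₀
  obtain ⟨W₁, hW₁, Q₁, c₁, hQ₁⟩ := h₁
  let e : Fin a ⊕ Fin 1 ⊕ W → Fin a ⊕ Fin b ⊕ (Fin 1 ⊕ W ⊕ W₀ ⊕ W₁)
    | Sum.inl l => Sum.inl l
    | Sum.inr (Sum.inl l) => Sum.inr (Sum.inr (Sum.inl l))
    | Sum.inr (Sum.inr w) => Sum.inr (Sum.inr (Sum.inr (Sum.inl w)))
  let e₀ : Fin a ⊕ Fin b ⊕ W₀ → Fin a ⊕ Fin b ⊕ (Fin 1 ⊕ W ⊕ W₀ ⊕ W₁)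
    | Sum.inl l => Sum.inl l
    | Sum.inr (Sum.inl l) => Sum.inr (Sum.inl l)
    | Sum.inr (Sum.inr w) => Sum.inr (Sum.inr (Sum.inr (Sum.inr (Sum.inl w))))
  let e₁ : Fin a ⊕ Fin b ⊕ W₁ → Fin a ⊕ Fin b ⊕ (Fin 1 ⊕ W ⊕ W₀ ⊕ W₁)
    | Sum.inl l => Sum.inl l
    | Sum.inr (Sum.inl l) => Sum.inr (Sum.inl l)
    | Sum.inr (Sum.inr w) => Sum.inr (Sum.inr (Sum.inr (Sum.inr (Sum.inr w))))
  have he : Function.Injective e := by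
    rintro (x | x | x) (y | y | y) hxy <;> simp_all [e]
  have he₀ : Function.Injective e₀ := by
    rintro (x | x | x) (y | y | y) hxy <;> simp_all [e₀]
  have he₁ : Function.Injective e₁ := by
    rintro (x | x | x) (y | y | y) hxy <;> simp_all [e₁]
  -- A number is zero exactly if the cell under the head of its tape is blank.
  let test : (Fin a ⊕ Fin b ⊕ (Fin 1 ⊕ W ⊕ W₀ ⊕ W₁) → Option Bool) → Bool :=
    fun s => (s (Sum.inr (Sum.inr (Sum.inl 0)))).isSome
  refine ⟨Fin 1 ⊕ W ⊕ W₀ ⊕ W₁, inferInstance,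
    (P.embed e).branch test (fun v => if v then Q₁.embed e₁ else Q₀.embed e₀),
    c + (c₀ + c₁) + 1, fun x hx => ?_⟩
  obtain ⟨T, hT, hT1, hT2⟩ := hP x hx
  have key1 : initTapes (W := Fin b ⊕ (Fin 1 ⊕ W ⊕ W₀ ⊕ W₁)) (f x) ∘ e = initTapes (f x) := by
    funext k; rcases k with k | k | k <;> rfl
  rw [← key1] at hT
  have r1 := hT.embed he
  set T1 := Function.extend e T (initTapes (W := Fin b ⊕ (Fin 1 ⊕ W ⊕ W₀ ⊕ W₁)) (f x))
    with hT1def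
  have v1 : ∀ k, T1 (e k) = T k := fun k => he.extend_apply _ _ _
  have v2 : ∀ k, (¬ ∃ l, e l = k) → T1 k = initTapes (f x) k :=
    fun k hk => Function.extend_apply' _ _ _ hk
  have hhead : T1 (Sum.inr (Sum.inr (Sum.inl 0))) = numTape (h x) :=
    (v1 (Sum.inr (Sum.inl 0))).trans (hT2 0)
  by_cases hx0 : h x = 0
  · obtain ⟨S, hS, hS1, hS2⟩ := hQ₀ x ⟨hx, hx0⟩
    have key2 : T1 ∘ e₀ = initTapes (f x) := by
      funext k
      rcases k with k | k | k
      · exact (v1 (Sum.inl k)).trans (hT1 k)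
      · refine (v2 _ ?_).trans rfl
        rintro ⟨(l | l | l), hl⟩ <;> simp [e, e₀] at hl
      · refine (v2 _ ?_).trans rfl
        rintro ⟨(l | l | l), hl⟩ <;> simp [e, e₀] at hl
    rw [← key2] at hS
    have r2 := hS.embed he₀
    have ht : test (fun k => (T1 k).head) = false := by
      simp only [test, hhead, hx0]
      rfl
    refine ⟨_, (r1.branch ht (T'' := Function.extend e₀ S T1) r2).mono ?_,
      fun l => ?_, fun l => ?_⟩
    · nlinarith [Nat.zero_le (Nat.log 2 (n x)), Nat.zero_le (c₁ * (Nat.log 2 (n x) + 1))]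
    · exact (he₀.extend_apply S T1 (Sum.inl l)).trans (hS1 l)
    · simp only [if_pos hx0]
      exact (he₀.extend_apply S T1 (Sum.inr (Sum.inl l))).trans (hS2 l)
  · obtain ⟨S, hS, hS1, hS2⟩ := hQ₁ x ⟨hx, hx0⟩
    have key2 : T1 ∘ e₁ = initTapes (f x) := by
      funext k
      rcases k with k | k | k
      · exact (v1 (Sum.inl k)).trans (hT1 k)
      · refine (v2 _ ?_).trans rfl
        rintro ⟨(l | l | l), hl⟩ <;> simp [e, e₁] at hl
      · refine (v2 _ ?_).trans rfl
        rintro ⟨(l | l | l), hl⟩ <;> simp [e, e₁] at hl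
    rw [← key2] at hS
    have r2 := hS.embed he₁
    have ht : test (fun k => (T1 k).head) = true := by
      simp only [test, hhead]
      cases hb : (h x).bits with
      | nil =>
        have := Nat.size_eq_bits_len (h x)
        rw [hb] at this
        exact absurd (Nat.size_eq_zero.1 this.symm) hx0
      | cons s l =>
        rw [numTape_eq_tapeOf, hb, List.map_cons, tapeOf_head_cons]
        rfl
    refine ⟨_, (r1.branch ht (T'' := Function.extend e₁ S T1) r2).mono ?_,
      fun l => ?_, fun l => ?_⟩
    · nlinarith [Nat.zero_le (Nat.log 2 (n x)), Nat.zero_le (c₀ * (Nat.log 2 (n x) + 1))]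
    · exact (he₁.extend_apply S T1 (Sum.inl l)).trans (hS1 l)
    · simp only [if_neg hx0]
      exact (he₁.extend_apply S T1 (Sum.inr (Sum.inl l))).trans (hS2 l)

lemma Computes.mono {X : Type} {a b : ℕ} {D D' : Set X} {n : X → ℕ} {f : X → Fin a → ℕ}
    {g : X → Fin b → ℕ} (h : Computes D n f g) (hD : D' ⊆ D) : Computes D' n f g := by
  obtain ⟨W, hW, P, c, h⟩ := h
  exact ⟨W, hW, P, c, fun x hx => h x (hD hx)⟩

lemma Computes.congr {X : Type} {a b : ℕ} {D : Set X} {n : X → ℕ} {f : X → Fin a → ℕ}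
    {g g' : X → Fin b → ℕ} (h : Computes D n f g) (hg : ∀ x ∈ D, g x = g' x) :
    Computes D n f g' := by
  obtain ⟨W, hW, P, c, h⟩ := h
  refine ⟨W, hW, P, c, fun x hx => ?_⟩
  rw [← hg x hx]
  exact h x hx

/-! ## Transducers -/

namespace TapeProg

open MultiTapeTM

variable {K : Type}

/-- The tape that holds `c.reverse ++ r`, with the head on the first entry of `c`, or on the blank
before `r` if there is none. -/
def backTape : List Bool → List Bool → Turing.Tape (Option Bool)
  | [], r => tapeOf [] (none :: r.map some)
  | b :: c, r => tapeOf (c.map some) (some b :: r.map some)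

lemma tapeOf_move_left_eq_backTape (c r : List Bool) :
    (tapeOf (c.map some) (r.map some)).move Turing.Dir.left = backTape c r := by
  cases c with
  | nil => exact tapeOf_move_left_nil _
  | cons b c => exact tapeOf_move_left _ _ _

open Classical in
/-- Move all heads back to the first symbols of their tapes. -/
noncomputable def rewind (K : Type) : TapeProg K where
  State := Fin 3
  finState := inferInstance
  start := 0
  trans q h :=
    match q with
    | 0 => some (1, fun k => (h k, some Turing.Dir.left))
    | 1 =>
      if ∀ k, h k = none then some (2, fun k => (h k, some Turing.Dir.right))
      else some (1, fun k => (h k, if (h k).isSome then some Turing.Dir.left else none))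
    | 2 => none

lemma act_move (T : Turing.Tape (Option Bool)) (d : Turing.Dir) :
    act T (T.head, some d) = T.move d := by
  simp [act, Turing.Tape.write_self]

/-- Heads that have reached the blank before their word wait there for the others, so the time is
governed by the largest distance; one common step to the right then puts all heads on the first
symbols. -/
lemma rewind_run_back (B : ℕ) : ∀ (c r : K → List Bool), (∀ k, (c k).length ≤ B) →
    ∃ t ≤ B + 1, (rewind K).Run (1 : Fin 3) (fun k => backTape (c k) (r k))
      (fun k => tapeOf [] (((c k).reverse ++ r k).map some)) t := by
  induction B with
  | zero =>
    intro c r hc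
    have hc' : ∀ k, c k = [] := fun k => List.length_eq_zero_iff.1 (Nat.le_zero.1 (hc k))
    refine ⟨1, by omega, Run.step (r := ((2 : Fin 3), fun k =>
      ((backTape (c k) (r k)).head, some Turing.Dir.right))) ?_ ?_⟩
    · simp only [rewind]
      rw [if_pos]
      intro k
      rw [hc' k]; rfl
    · have : (fun k => act (backTape (c k) (r k)) ((backTape (c k) (r k)).head,
          some Turing.Dir.right)) = fun k => tapeOf [] (((c k).reverse ++ r k).map some) := by
        funext k
        rw [act_move, hc' k]
        simp only [backTape, tapeOf_move_right, tapeOf_blank_left, List.reverse_nil,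
          List.nil_append]
      rw [← this]
      exact Run.halt rfl
  | succ B ih =>
    intro c r hc
    by_cases h0 : ∀ k, c k = []
    · obtain ⟨t, ht, h⟩ := ih c r (fun k => by simp [h0 k])
      exact ⟨t, by omega, h⟩
    · push Not at h0
      obtain ⟨t, ht, h⟩ := ih (fun k => (c k).tail) (fun k => (c k).head?.toList ++ r k)
        (fun k => by have := hc k; simp; omega)
      refine ⟨t + 1, by omega, Run.step (r := ((1 : Fin 3), fun k =>
        ((backTape (c k) (r k)).head, if ((backTape (c k) (r k)).head).isSome then
          some Turing.Dir.left else none))) ?_ ?_⟩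
      · simp only [rewind]
        rw [if_neg]
        obtain ⟨k, hk⟩ := h0
        intro h
        have := h k
        cases hck : c k with
        | nil => exact hk hck
        | cons b l => rw [hck] at this; cases this
      · convert h using 1
        · funext k
          simp only
          cases hck : c k with
          | nil => exact act_stay _
          | cons b l =>
            refine (act_move _ _).trans ?_
            exact tapeOf_move_left_eq_backTape l (b :: r k)
        · funext k
          cases hck : c k <;> simp

lemma rewind_runsWithin {B : ℕ} {c r : K → List Bool} (hc : ∀ k, (c k).length ≤ B) :
    (rewind K).RunsWithin (fun k => tapeOf ((c k).map some) ((r k).map some))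
      (fun k => tapeOf [] (((c k).reverse ++ r k).map some)) (B + 2) := by
  obtain ⟨t, ht, h⟩ := rewind_run_back B c r hc
  refine ⟨t + 1, by omega, Run.step (r := ((1 : Fin 3), fun k =>
    ((tapeOf ((c k).map some) ((r k).map some)).head, some Turing.Dir.left))) rfl ?_⟩
  convert h using 1
  funext k
  rw [act_move, tapeOf_move_left_eq_backTape]

open Classical in
/-- Remove the digits `0` directly before the head of tape `o`. -/
noncomputable def trim (o : K) : TapeProg K where
  State := Fin 3
  finState := inferInstance
  start := 0
  trans q h :=
    match q with
    | 0 => some (1, Function.update (fun k => (h k, none)) o (h o, some Turing.Dir.left))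
    | 1 =>
      if h o = some false then
        some (1, Function.update (fun k => (h k, none)) o (none, some Turing.Dir.left))
      else some (2, Function.update (fun k => (h k, none)) o (h o, some Turing.Dir.right))
    | 2 => none

open Classical in
lemma act_update (T : K → Turing.Tape (Option Bool)) (o : K)
    (s : Option Bool × Option Turing.Dir) :
    (fun k => act (T k) (Function.update (fun k => ((T k).head, none)) o s k)) =
      Function.update T o (act (T o) s) := by
  funext k
  by_cases hk : k = o
  · subst hk; simp
  · simp [hk, act_stay]

open Classical in
lemma trim_run_back (o : K) (T : K → Turing.Tape (Option Bool)) : ∀ E : List Bool,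
    T o = backTape E [] → ∃ t ≤ E.length + 1, (trim o).Run (1 : Fin 3) T
      (Function.update T o (tapeOf ((E.dropWhile not).map some) [])) t := by
  intro E
  induction E generalizing T with
  | nil =>
    intro hT
    refine ⟨1, by simp, Run.step (r := ((2 : Fin 3), Function.update (fun k => ((T k).head, none)) o
      ((T o).head, some Turing.Dir.right))) ?_ ?_⟩
    · simp only [trim]
      rw [if_neg]
      rw [hT]; rintro ⟨⟩
    · rw [act_update, act_move, hT]
      simp only [backTape, List.map_nil, tapeOf_move_right, List.dropWhile_nil, tapeOf_blank_left]
      exact Run.halt rfl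
  | cons b E ih =>
    intro hT
    cases b with
    | true =>
      refine ⟨1, by simp, Run.step (r := ((2 : Fin 3), Function.update
        (fun k => ((T k).head, none)) o ((T o).head, some Turing.Dir.right))) ?_ ?_⟩
      · simp only [trim]
        rw [if_neg]
        rw [hT]; rintro ⟨⟩
      · rw [act_update, act_move, hT]
        simp only [backTape, List.map_nil, tapeOf_move_right]
        exact Run.halt rfl
    | false =>
      obtain ⟨t, ht, h⟩ := ih (Function.update T o (backTape E [])) (by simp)
      refine ⟨t + 1, by simp; omega, Run.step (r := ((1 : Fin 3), Function.update
        (fun k => ((T k).head, none)) o (none, some Turing.Dir.left))) ?_ ?_⟩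
      · simp only [trim]
        rw [if_pos]
        rw [hT]; rfl
      · rw [act_update]
        have : act (T o) (none, some Turing.Dir.left) = backTape E [] := by
          rw [hT]
          simp only [act, backTape, List.map_nil, tapeOf_write]
          rw [← tapeOf_nil_eq]
          exact tapeOf_move_left_eq_backTape E []
        rw [this]
        simpa using h

open Classical in
lemma trim_runsWithin {o : K} {T : K → Turing.Tape (Option Bool)} {E : List Bool}
    (hT : T o = tapeOf (E.map some) []) :
    (trim o).RunsWithin T (Function.update T o (tapeOf ((E.dropWhile not).map some) []))
      (E.length + 2) := by
  obtain ⟨t, ht, h⟩ := trim_run_back o (Function.update T o (backTape E [])) E (by simp)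
  refine ⟨t + 1, by omega, Run.step (r := ((1 : Fin 3), Function.update
    (fun k => ((T k).head, none)) o ((T o).head, some Turing.Dir.left))) rfl ?_⟩
  rw [act_update, act_move, hT]
  have := tapeOf_move_left_eq_backTape E []
  rw [List.map_nil] at this
  rw [this]
  simpa using h

end TapeProg

/-- A finite-state machine that reads `m` numbers in binary, least significant digits first, and
emits the digits of a number. In one step it may halt, or it selects the arguments to be shifted
and possibly emits a digit. -/
structure Transducer (m : ℕ) where
  State : Type
  finState : Finite State
  start : State
  step : State → (Fin m → Option Bool) → Option (State × (Fin m → Bool) × Option Bool)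

namespace Transducer

open TapeProg MultiTapeTM

variable {m : ℕ}

/-- The least significant digit. -/
def lowDigit (x : ℕ) : Option Bool := x.bits.head?

/-- Shift the selected numbers to the right. -/
def shift (mv : Fin m → Bool) (x : Fin m → ℕ) : Fin m → ℕ :=
  fun k => if mv k then x k / 2 else x k

/-- From state `q` and arguments `x`, the transducer emits `y` in `t` steps. -/
inductive Emits (A : Transducer m) : A.State → (Fin m → ℕ) → ℕ → ℕ → Prop
  | halt {q x} (h : A.step q (fun k => lowDigit (x k)) = none) : Emits A q x 0 0
  | quiet {q x y t q' mv} (h : A.step q (fun k => lowDigit (x k)) = some (q', mv, none))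
      (hr : Emits A q' (shift mv x) y t) : Emits A q x y (t + 1)
  | emit {q x y t q' mv b} (h : A.step q (fun k => lowDigit (x k)) = some (q', mv, some b))
      (hr : Emits A q' (shift mv x) y t) : Emits A q x (Nat.bit b y) (t + 1)

/-- The action on the tapes with the symbols `h` under the heads, when the arguments `mv` are
shifted and `e` is emitted. -/
def scanAct (mv : Fin m → Bool) (e : Option Bool) (h : Fin m ⊕ Fin 1 ⊕ Empty → Option Bool) :
    Fin m ⊕ Fin 1 ⊕ Empty → Option Bool × Option Turing.Dir
  | Sum.inl k => (h (Sum.inl k),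
      if mv k && (h (Sum.inl k)).isSome then some Turing.Dir.right else none)
  | Sum.inr l =>
      match e with
      | none => (h (Sum.inr l), none)
      | some b => (some b, some Turing.Dir.right)

/-- The program of a transducer, without the final clean-up. -/
def scan (A : Transducer m) : TapeProg (Fin m ⊕ Fin 1 ⊕ Empty) where
  State := A.State
  finState := A.finState
  start := A.start
  trans q h := (A.step q (fun k => h (Sum.inl k))).map fun r => (r.1, scanAct r.2.1 r.2.2 h)

/-- The digits on the tapes before the heads: `c` on the input tapes, `E` on the output tape. -/
def joinTapes (c : Fin m → List Bool) (E : List Bool) : Fin m ⊕ Fin 1 ⊕ Empty → List Bool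
  | Sum.inl k => c k
  | Sum.inr _ => E

lemma bits_div_two (x : ℕ) : (x / 2).bits = x.bits.tail := by
  rw [← Nat.div2_val, Nat.div2_bits_eq_tail]

/-- `E` lists emitted digits with the latest, most significant one first, so leading zeros of the
number are a prefix of `E`. Prepending a lowest digit `b` to the number appends it to `E`. -/
lemma bits_bit_of_trim {y : ℕ} {E : List Bool} (b : Bool)
    (h : y.bits = (E.dropWhile not).reverse) :
    (Nat.bit b y).bits = ((E ++ [b]).dropWhile not).reverse := by
  rw [List.dropWhile_append]
  by_cases hy : y = 0
  · subst hy
    have h' : E.dropWhile not = [] := by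
      rw [Nat.zero_bits] at h
      exact List.reverse_eq_nil_iff.1 h.symm
    rw [h']
    cases b <;> simp
  · rw [Nat.bits_append_bit _ _ (fun h0 => absurd h0 hy), if_neg]
    · simp [h]
    · intro h0
      rw [List.isEmpty_iff.1 h0, List.reverse_nil] at h
      have := Nat.size_eq_bits_len y
      rw [h] at this
      exact hy (Nat.size_eq_zero.1 this.symm)

/-- The invariant ties the current argument to the unread part of its tape, and keeps the read part
to the left of the head. The length bounds make the later rewinding cost no more than the scan
itself, even if an argument is much longer than the part that was read. -/
lemma Emits.scan_run {A : Transducer m} {q : A.State} {x : Fin m → ℕ} {y t : ℕ}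
    (h : A.Emits q x y t) : ∀ (c : Fin m → List Bool) (E : List Bool),
    ∃ (c' r' : Fin m → List Bool) (E' : List Bool),
      A.scan.Run q
        (fun k => tapeOf ((joinTapes c E k).map some)
          ((joinTapes (fun k => (x k).bits) [] k).map some))
        (fun k => tapeOf ((joinTapes c' (E' ++ E) k).map some) ((joinTapes r' [] k).map some)) t ∧
      (∀ k, (c' k).reverse ++ r' k = (c k).reverse ++ (x k).bits) ∧
      (∀ k, (c' k).length ≤ (c k).length + t) ∧ E'.length ≤ t ∧
      y.bits = (E'.dropWhile not).reverse := by
  have head_in : ∀ (c : Fin m → List Bool) (E : List Bool) (x : Fin m → ℕ) (k : Fin m),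
      (tapeOf ((joinTapes c E (Sum.inl k)).map some)
        ((joinTapes (fun k => (x k).bits) [] (Sum.inl k)).map some)).head = lowDigit (x k) := by
    intro c E x k
    simp only [joinTapes, lowDigit]
    cases (x k).bits <;> rfl
  have shift_in : ∀ (l : List Bool) (x : ℕ) (v : Bool), ∃ l' : List Bool,
      act (tapeOf (l.map some) (x.bits.map some)) (lowDigit x,
        if v && (lowDigit x).isSome then some Turing.Dir.right else none) =
      tapeOf (l'.map some) ((if v then x / 2 else x).bits.map some) ∧
      l'.reverse ++ (if v then x / 2 else x).bits = l.reverse ++ x.bits ∧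
      l'.length ≤ l.length + 1 := by
    intro l x v
    cases v with
    | false =>
      refine ⟨l, ?_, by simp, by simp⟩
      simp only [Bool.false_and, lowDigit, Bool.false_eq_true, if_false]
      cases x.bits with
      | nil => exact act_stay _
      | cons b r => exact act_stay _
    | true =>
      simp only [if_true, bits_div_two, Bool.true_and, lowDigit]
      cases hb : x.bits with
      | nil => exact ⟨l, act_stay _, by simp, by simp⟩
      | cons b r =>
        refine ⟨b :: l, ?_, by simp, by simp⟩
        exact (act_move _ _).trans (tapeOf_move_right _ _ _)
  induction h with
  | @halt q x h =>
    intro c E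
    refine ⟨c, fun k => (x k).bits, [], Run.halt ?_, fun _ => rfl, fun _ => le_rfl, le_rfl, rfl⟩
    simp only [scan, head_in, h, Option.map_none]
  | @quiet q x y t q' mv h hr ih =>
    intro c E
    choose d hd1 hd2 hd3 using fun k => shift_in (c k) (x k) (mv k)
    obtain ⟨c', r', E', h1, h2, h3, h4, h5⟩ := ih d E
    refine ⟨c', r', E', Run.step (r := (q', scanAct mv none (fun k =>
        (tapeOf ((joinTapes c E k).map some)
          ((joinTapes (fun k => (x k).bits) [] k).map some)).head))) ?_ ?_,
      fun k => (h2 k).trans (hd2 k), fun k => ?_, by omega, h5⟩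
    · simp only [scan, head_in, h, Option.map_some]
    · convert h1 using 1
      funext k
      rcases k with k | k
      · simp only [scanAct, head_in]
        exact hd1 k
      · exact act_stay _
    · have := h3 k; have := hd3 k; omega
  | @emit q x y t q' mv b h hr ih =>
    intro c E
    choose d hd1 hd2 hd3 using fun k => shift_in (c k) (x k) (mv k)
    obtain ⟨c', r', E', h1, h2, h3, h4, h5⟩ := ih d (b :: E)
    refine ⟨c', r', E' ++ [b], Run.step (r := (q', scanAct mv (some b) (fun k =>
        (tapeOf ((joinTapes c E k).map some)
          ((joinTapes (fun k => (x k).bits) [] k).map some)).head))) ?_ ?_,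
      fun k => (h2 k).trans (hd2 k), fun k => ?_, by simp; omega, bits_bit_of_trim b h5⟩
    · simp only [scan, head_in, h, Option.map_some]
    · rw [List.append_assoc, List.singleton_append]
      convert h1 using 1
      funext k
      rcases k with k | k
      · simp only [scanAct, head_in]
        exact hd1 k
      · simp only [scanAct, joinTapes, List.map_nil, act]
        rw [tapeOf_nil_eq, tapeOf_write, tapeOf_move_right]
        rfl
    · have := h3 k; have := hd3 k; omega

lemma computes {X : Type} (A : Transducer m) {D : Set X} {n : X → ℕ} {f : X → Fin m → ℕ}
    {g : X → ℕ} (c : ℕ)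
    (h : ∀ x ∈ D, ∃ t ≤ c * (Nat.log 2 (n x) + 1), A.Emits A.start (f x) (g x) t) :
    Computes D n f (fun x => ![g x]) := by
  classical
  refine ⟨Empty, inferInstance, (A.scan.seq (trim (Sum.inr (Sum.inl 0)))).seq (rewind _),
    -- Scanning takes `t` steps, trimming at most `t + 2`, rewinding `t + 2`, and two steps join
    -- them: at most `3 * t + 6`.
    3 * c + 6, fun x hx => ?_⟩
  obtain ⟨t, ht, hE⟩ := h x hx
  obtain ⟨c', r', E', h1, h2, h3, h4, h5⟩ := hE.scan_run (fun _ => []) []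
  rw [List.append_nil] at h1
  have hinit : (fun k => tapeOf ((joinTapes (fun _ => []) [] k).map some)
      ((joinTapes (fun k => (f x k).bits) [] k).map some)) = initTapes (f x) := by
    funext k
    rcases k with k | k
    · rfl
    · simp only [initTapes, joinTapes, numTape_eq_tapeOf, Nat.zero_bits, List.map_nil]
  rw [hinit] at h1
  have s1 : A.scan.RunsWithin (initTapes (f x)) _ t := ⟨t, le_rfl, h1⟩
  have s2 := s1.seq (trim_runsWithin (o := Sum.inr (Sum.inl 0)) (E := E') rfl)
  have hup : Function.update (fun k => tapeOf ((joinTapes c' E' k).map some)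
      ((joinTapes r' [] k).map some)) (Sum.inr (Sum.inl 0))
      (tapeOf ((E'.dropWhile not).map some) []) =
      fun k => tapeOf ((joinTapes c' (E'.dropWhile not) k).map some)
        ((joinTapes r' [] k).map some) := by
    funext k
    rcases k with k | k | k
    · rfl
    · obtain rfl : k = 0 := Subsingleton.elim _ _
      rw [Function.update_self]
      rfl
    · exact k.elim
  replace s2 : (A.scan.seq (trim (Sum.inr (Sum.inl 0)))).RunsWithin (initTapes (f x))
      (fun k => tapeOf ((joinTapes c' (E'.dropWhile not) k).map some)
        ((joinTapes r' [] k).map some)) (t + (E'.length + 2) + 1) := by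
    rw [← hup]
    convert s2
  have s3 := s2.seq (rewind_runsWithin (B := t) (by
    rintro (k | k | k)
    · simpa [joinTapes] using h3 k
    · exact ((List.dropWhile_suffix _).length_le).trans h4
    · exact k.elim))
  refine ⟨_, s3.mono ?_, fun l => ?_, fun l => ?_⟩
  · nlinarith [Nat.zero_le (Nat.log 2 (n x))]
  · simp only [joinTapes]
    rw [h2 l]
    rfl
  · simp only [joinTapes]
    rw [List.append_nil, ← h5]
    obtain rfl : l = 0 := Subsingleton.elim _ _
    rfl

end Transducer

/-! ### Transducers for copying, constants, powers of two, truncation and tests -/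

namespace Transducer

variable {m : ℕ}

lemma lowDigit_zero : lowDigit 0 = none := by simp [lowDigit]

lemma lowDigit_of_ne_zero {x : ℕ} (hx : x ≠ 0) : lowDigit x = some x.bodd := by
  have h := Nat.size_eq_bits_len x
  rw [Nat.bodd_eq_bits_head, lowDigit]
  cases hb : x.bits with
  | nil =>
    rw [hb] at h
    exact absurd (Nat.size_eq_zero.1 h.symm) hx
  | cons b l => rfl

lemma bit_bodd_div_two (x : ℕ) : Nat.bit x.bodd (x / 2) = x := by
  rw [← Nat.div2_val, Nat.bit_bodd_div2]

lemma size_eq_size_div_two_add {x : ℕ} (hx : x ≠ 0) : x.size = (x / 2).size + 1 := by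
  conv_lhs => rw [← bit_bodd_div_two x]
  rw [Nat.size_bit]
  rwa [bit_bodd_div_two]

lemma size_div_two_le (x : ℕ) : (x / 2).size ≤ x.size - 1 := by
  rcases eq_or_ne x 0 with rfl | hx
  · simp
  · rw [size_eq_size_div_two_add hx]; rfl

lemma size_le_log (n : ℕ) : n.size ≤ Nat.log 2 n + 1 :=
  Nat.size_le.2 (Nat.lt_pow_succ_log_self (by norm_num) n)

/-- The transducer that copies its argument `l`. -/
def copyArg (l : Fin m) : Transducer m where
  State := Unit
  finState := inferInstance
  start := ()
  step _ h := (h l).map (fun b => ((), fun k => decide (k = l), some b))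

lemma copyArg_emits (l : Fin m) (s : ℕ) : ∀ x : Fin m → ℕ, (x l).size = s →
    (copyArg l).Emits () x (x l) s := by
  induction s with
  | zero =>
    intro x hx
    have h0 := Nat.size_eq_zero.1 hx
    rw [h0]
    exact Emits.halt (by simp [copyArg, h0, lowDigit_zero])
  | succ s ih =>
    intro x hx
    have h0 : x l ≠ 0 := by rintro h; rw [h] at hx; simp at hx
    rw [size_eq_size_div_two_add h0] at hx
    rw [← bit_bodd_div_two (x l)]
    refine Emits.emit (q' := ()) (mv := fun k => decide (k = l)) (b := (x l).bodd)
      (by simp [copyArg, lowDigit_of_ne_zero h0]) ?_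
    have := ih (shift (fun k => decide (k = l)) x) (by simp [shift]; omega)
    simpa [shift] using this

/-- The transducer that emits the number `v`. -/
def const (m v : ℕ) : Transducer m where
  State := Fin (v + 1)
  finState := inferInstance
  start := Fin.last v
  step j _ := if j.val = 0 then none else
    some (⟨j.val / 2, by have := j.2; omega⟩, fun _ => false, some j.val.bodd)

lemma const_emits {v : ℕ} (x : Fin m → ℕ) (s : ℕ) : ∀ j : Fin (v + 1), j.val.size = s →
    (const m v).Emits j x j.val s := by
  induction s with
  | zero =>
    intro j hj
    have h0 := Nat.size_eq_zero.1 hj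
    rw [h0]
    exact Emits.halt (by simp [const, h0])
  | succ s ih =>
    intro j hj
    have h0 : j.val ≠ 0 := by rintro h; rw [h] at hj; simp at hj
    rw [size_eq_size_div_two_add h0] at hj
    have := ih ⟨j.val / 2, by have := j.2; omega⟩ (by simp; omega)
    conv => arg 4; rw [← bit_bodd_div_two j.val]
    exact Emits.emit (mv := fun _ => false) (by simp only [const, if_neg h0]) this

/-- The transducer for the quotient by a power of `2`. -/
def divPow : Transducer 2 where
  State := Bool
  finState := inferInstance
  start := false
  step q h :=
    match q, h 0, h 1 with
    | false, _, some false => some (false, ![true, true], none)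
    | false, _, some true => some (true, ![false, false], none)
    | false, _, none => none
    | true, none, _ => none
    | true, some b, _ => some (true, ![true, false], some b)

lemma lowDigit_two_pow_succ (k : ℕ) : lowDigit (2 ^ (k + 1)) = some false := by
  rw [lowDigit_of_ne_zero (by positivity), pow_succ]
  simp

lemma divPow_emits_rest (s : ℕ) : ∀ x : Fin 2 → ℕ, (x 0).size = s →
    divPow.Emits true x (x 0) s := by
  induction s with
  | zero =>
    intro x hx
    have h0 := Nat.size_eq_zero.1 hx
    rw [h0]
    exact Emits.halt (by simp [divPow, h0, lowDigit_zero])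
  | succ s ih =>
    intro x hx
    have h0 : x 0 ≠ 0 := by rintro h; rw [h] at hx; simp at hx
    rw [size_eq_size_div_two_add h0] at hx
    rw [← bit_bodd_div_two (x 0)]
    refine Emits.emit (q' := true) (mv := ![true, false]) (b := (x 0).bodd)
      (by simp [divPow, lowDigit_of_ne_zero h0]) ?_
    have := ih (shift ![true, false] x) (by simp [shift]; omega)
    simpa [shift] using this

/-- Each of the `k` low zeros of `2 ^ k` discards one digit of `x 0`; its leading one switches to
copying what is left. -/
lemma divPow_emits (k : ℕ) : ∀ x : Fin 2 → ℕ, x 1 = 2 ^ k →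
    ∃ t ≤ k + 1 + (x 0).size, divPow.Emits false x (x 0 / 2 ^ k) t := by
  induction k with
  | zero =>
    intro x hx
    refine ⟨(x 0).size + 1, by omega, Emits.quiet (q' := true) (mv := ![false, false])
      (by simp [divPow, hx, lowDigit]) ?_⟩
    have := divPow_emits_rest _ (shift ![false, false] x) rfl
    simpa [shift] using this
  | succ k ih =>
    intro x hx
    obtain ⟨t, ht, h⟩ := ih (shift ![true, true] x) (by simp [shift, hx, pow_succ])
    refine ⟨t + 1, ?_, Emits.quiet (q' := false) (mv := ![true, true])
      (by simp [divPow, hx, lowDigit_two_pow_succ]) ?_⟩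
    · have := size_div_two_le (x 0)
      simp only [shift, Matrix.cons_val_zero, if_true] at ht
      omega
    · have e : x 0 / 2 ^ (k + 1) = x 0 / 2 / 2 ^ k := by
        rw [Nat.div_div_eq_div_mul, pow_succ, mul_comm]
      rw [e]
      simpa [shift] using h

/-- The transducer for the remainder modulo a power of `2`. -/
def modPow : Transducer 2 where
  State := Unit
  finState := inferInstance
  start := ()
  step _ h :=
    match h 1 with
    | some false => some ((), ![true, true], some ((h 0).getD false))
    | _ => none

lemma lowDigit_getD (x : ℕ) : (lowDigit x).getD false = x.bodd := by
  rcases eq_or_ne x 0 with rfl | hx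
  · simp [lowDigit_zero]
  · rw [lowDigit_of_ne_zero hx]; rfl

lemma bit_bodd_eq (x y : ℕ) : Nat.bit x.bodd y = x % 2 + 2 * y := by
  rw [Nat.mod_two_of_bodd]
  cases x.bodd <;> simp [add_comm]

/-- One digit of `x 0` is emitted for each low zero of `2 ^ k`, with blanks read as `0`. The time
depends on `k` alone, however long `x 0` is. -/
lemma modPow_emits (k : ℕ) : ∀ x : Fin 2 → ℕ, x 1 = 2 ^ k →
    modPow.Emits () x (x 0 % 2 ^ k) k := by
  induction k with
  | zero =>
    intro x hx
    rw [pow_zero, Nat.mod_one]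
    exact Emits.halt (by simp [modPow, hx, lowDigit])
  | succ k ih =>
    intro x hx
    have e : x 0 % 2 ^ (k + 1) = Nat.bit (x 0).bodd (x 0 / 2 % 2 ^ k) := by
      rw [bit_bodd_eq, pow_succ', Nat.mod_mul]
    rw [e]
    have h := ih (shift ![true, true] x) (by simp [shift, hx, pow_succ])
    refine Emits.emit (q' := ()) (mv := ![true, true])
      (by simp [modPow, hx, lowDigit_two_pow_succ, lowDigit_getD]) ?_
    simpa [shift] using h

/-- The number `i` if it has at most `B` digits, and a large number otherwise. -/
def clip (B i : ℕ) : ℕ := if i < 2 ^ B then i else i % 2 ^ B + 2 ^ B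

/-- The low `B` digits are kept, and a one at position `B` records whether any higher digit was
lost. This recursion is what a digit-by-digit machine realises. -/
lemma clip_succ (B i : ℕ) : clip (B + 1) i = Nat.bit i.bodd (clip B (i / 2)) := by
  have h1 : i % 2 ^ (B + 1) = i % 2 + 2 * (i / 2 % 2 ^ B) := by rw [pow_succ', Nat.mod_mul]
  have h2 : i < 2 ^ (B + 1) ↔ i / 2 < 2 ^ B := by rw [pow_succ]; omega
  rw [bit_bodd_eq, clip, clip, h1]
  simp only [h2]
  split_ifs
  · omega
  · rw [pow_succ]; omega

/-- The transducer that maps `n, i` to `clip (c * (n.size + 1)) i`. -/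
def clipper (c : ℕ) : Transducer 2 where
  State := Option (Fin (c + 1))
  finState := inferInstance
  start := some (Fin.last c)
  step q h :=
    match q with
    | none => none
    | some j =>
      if j.val = 0 then
        match h 0 with
        | none => if (h 1).isSome then some (none, ![false, false], some true) else none
        | some _ => some (some (Fin.last c), ![true, false], none)
      else some (some ⟨j.val - 1, by have := j.2; omega⟩, ![false, true],
        some ((h 1).getD false))

/-- The state counts down from `c` while digits of `x 1` are emitted; at zero one digit of `x 0` is
consumed and the counter is reset. Thus `c * s + v` digits are still to come when `x 0` has `s`
digits left and the counter shows `v`. -/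
lemma clipper_emits (c s : ℕ) : ∀ (v : ℕ) (j : Fin (c + 1)) (x : Fin 2 → ℕ), j.val = v →
    (x 0).size = s → ∃ t ≤ (c + 1) * s + v + 1,
      (clipper c).Emits (some j) x (clip (c * s + v) (x 1)) t := by
  induction s with
  | zero =>
    intro v
    induction v with
    | zero =>
      intro j x hj hx
      have h0 := Nat.size_eq_zero.1 hx
      by_cases h1 : x 1 = 0
      · refine ⟨0, by omega, ?_⟩
        rw [h1]
        exact Emits.halt (by simp [clipper, hj, h0, h1, lowDigit_zero])
      · refine ⟨1, by omega, ?_⟩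
        -- All permitted digits have been emitted but `x 1` is not exhausted: the overflow marker is
        -- emitted.
        have : clip (c * 0 + 0) (x 1) = Nat.bit true 0 := by
          simp [clip, h1, Nat.mod_one]
        rw [this]
        refine Emits.emit (q' := none) (mv := ![false, false])
          (by simp [clipper, hj, h0, lowDigit_zero, lowDigit_of_ne_zero h1]) (Emits.halt rfl)
    | succ v ih =>
      intro j x hj hx
      obtain ⟨t, ht, h⟩ := ih ⟨j.val - 1, by have := j.2; omega⟩ (shift ![false, true] x)
        (by simp [hj]) (by simpa [shift] using hx)
      refine ⟨t + 1, by omega, ?_⟩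
      rw [← add_assoc, clip_succ]
      exact Emits.emit (mv := ![false, true])
        (by simp only [clipper, lowDigit_getD, if_neg (show ¬ j.val = 0 by omega)]) h
  | succ s ihs =>
    intro v
    induction v with
    | zero =>
      intro j x hj hx
      have h0 : x 0 ≠ 0 := by rintro h; rw [h] at hx; simp at hx
      rw [size_eq_size_div_two_add h0] at hx
      obtain ⟨t, ht, h⟩ := ihs c (Fin.last c) (shift ![true, false] x) rfl
        (by simp [shift]; omega)
      refine ⟨t + 1, by nlinarith, ?_⟩
      rw [show c * (s + 1) + 0 = c * s + c by ring]
      refine Emits.quiet (q' := some (Fin.last c)) (mv := ![true, false])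
        (by simp [clipper, hj, lowDigit_of_ne_zero h0]) ?_
      simpa [shift] using h
    | succ v ih =>
      intro j x hj hx
      obtain ⟨t, ht, h⟩ := ih ⟨j.val - 1, by have := j.2; omega⟩ (shift ![false, true] x)
        (by simp [hj]) (by simpa [shift] using hx)
      refine ⟨t + 1, by omega, ?_⟩
      rw [← add_assoc, clip_succ]
      exact Emits.emit (mv := ![false, true])
        (by simp only [clipper, lowDigit_getD, if_neg (show ¬ j.val = 0 by omega)]) h

open Classical in
/-- The transducer that reads its arguments in parallel with the transition function `δ` and emits
the acceptance bit of the final state. -/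
noncomputable def ofTest {σ : Type} [Finite σ] (δ : σ → (Fin m → Bool) → σ) (s : σ)
    (acc : σ → Bool) : Transducer m where
  State := Option σ
  finState := inferInstance
  start := some s
  step q h :=
    match q with
    | none => none
    | some q =>
      if ∀ k, h k = none then some (none, fun _ => false, some (acc q))
      else some (some (δ q (fun k => (h k).getD false)), fun _ => true, none)

/-- `R s x` is the verdict from state `s` on the remaining numbers `x`. By `hR` it is invariant
under reading one digit of each, and by `h0` it is the acceptance bit once all numbers are
exhausted, shorter ones being padded with zeros. -/
lemma ofTest_emits {σ : Type} [Finite σ] {δ : σ → (Fin m → Bool) → σ} {s₀ : σ}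
    {acc : σ → Bool} {R : σ → (Fin m → ℕ) → Bool} (h0 : ∀ s, R s (fun _ => 0) = acc s)
    (hR : ∀ s x, R s x = R (δ s (fun k => (x k).bodd)) (fun k => x k / 2)) (B : ℕ) :
    ∀ (s : σ) (x : Fin m → ℕ), (∀ k, (x k).size ≤ B) →
      ∃ t ≤ B + 1, (ofTest δ s₀ acc).Emits (some s) x (R s x).toNat t := by
  have base : ∀ (s : σ) (x : Fin m → ℕ), (∀ k, x k = 0) →
      (ofTest δ s₀ acc).Emits (some s) x (R s x).toNat 1 := by
    intro s x hx
    obtain rfl : x = fun _ => 0 := funext hx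
    have : (R s fun _ => 0).toNat = Nat.bit (acc s) 0 := by
      rw [h0]; cases acc s <;> rfl
    rw [this]
    refine Emits.emit (q' := none) (mv := fun _ => false) ?_ (Emits.halt rfl)
    simp [ofTest, lowDigit_zero]
  induction B with
  | zero =>
    intro s x hx
    exact ⟨1, le_rfl, base s x (fun k => Nat.size_eq_zero.1 (Nat.le_zero.1 (hx k)))⟩
  | succ B ih =>
    intro s x hx
    by_cases hx0 : ∀ k, x k = 0
    · exact ⟨1, by omega, base s x hx0⟩
    · obtain ⟨t, ht, h⟩ := ih (δ s (fun k => (x k).bodd)) (fun k => x k / 2)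
        (fun k => by have := size_div_two_le (x k); have := hx k; omega)
      refine ⟨t + 1, by omega, ?_⟩
      rw [hR]
      refine Emits.quiet (q' := some (δ s (fun k => (x k).bodd))) (mv := fun _ => true) ?_ ?_
      · push Not at hx0
        obtain ⟨k, hk⟩ := hx0
        simp only [ofTest, lowDigit_getD]
        rw [if_neg]
        intro hall
        have := hall k
        rw [lowDigit_of_ne_zero hk] at this
        cases this
      · exact h

end Transducer

/-! ## Computable functions -/

lemma eq_bodd_add_two_mul (x : ℕ) : x = x.bodd.toNat + 2 * (x / 2) := by
  have := Nat.mod_two_of_bodd x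
  cases h : x.bodd <;> simp [h] at this ⊢ <;> omega

section Closure

variable {X : Type} {a b : ℕ} {D : Set X} {n : X → ℕ} {f : X → Fin a → ℕ}

/-- The numbers `g x` have `O(log (n x))` binary digits. -/
def LogSize (D : Set X) (n : X → ℕ) (g : X → ℕ) : Prop :=
  ∃ c, ∀ x ∈ D, (g x).size ≤ c * (Nat.log 2 (n x) + 1)

lemma logSize_self : LogSize D n n :=
  ⟨1, fun x _ => by rw [one_mul]; exact Transducer.size_le_log _⟩

lemma LogSize.of_le {g h : X → ℕ} (hg : LogSize D n g) (hh : ∀ x ∈ D, h x ≤ g x) :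
    LogSize D n h := by
  obtain ⟨c, hc⟩ := hg
  exact ⟨c, fun x hx => (Nat.size_le_size (hh x hx)).trans (hc x hx)⟩

lemma computes_arg (l : Fin a) (h : LogSize D n (fun x => f x l)) :
    Computes D n f (fun x => ![f x l]) := by
  obtain ⟨c, hc⟩ := h
  exact (Transducer.copyArg l).computes c
    (fun x hx => ⟨_, hc x hx, Transducer.copyArg_emits l _ (f x) rfl⟩)

lemma computes_const (v : ℕ) : Computes D n f (fun _ => ![v]) :=
  (Transducer.const a v).computes v.size (fun x _ =>
    ⟨v.size, Nat.le_mul_of_pos_right _ (Nat.succ_pos _),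
      Transducer.const_emits (f x) _ (Fin.last v) rfl⟩)

lemma Computes.div_pow {g s : X → ℕ} (hg : Computes D n f (fun x => ![g x]))
    (hs : Computes D n f (fun x => ![s x])) (hg' : LogSize D n g) (hs' : LogSize D n s)
    (hpow : ∀ x, ∃ k, s x = 2 ^ k) : Computes D n f (fun x => ![g x / s x]) := by
  refine (hg.cons hs).comp (Computes.tmComputes ?_)
  obtain ⟨c, hc⟩ := hg'
  obtain ⟨d, hd⟩ := hs'
  refine Transducer.divPow.computes (c + d) (fun x hx => ?_)
  obtain ⟨k, hk⟩ := hpow x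
  obtain ⟨t, ht, h⟩ := Transducer.divPow_emits k ![g x, s x] hk
  refine ⟨t, ht.trans ?_, ?_⟩
  · have h1 := hc x hx
    have h2 := hd x hx
    rw [hk, Nat.size_pow] at h2
    simp only [Matrix.cons_val_zero]
    nlinarith
  · rw [hk] at h ⊢
    exact h

/-- In contrast to the quotient, no bound on the length of `g` is needed, because only as many
digits are read as `s` has zeros. -/
lemma Computes.mod_pow {g s : X → ℕ} (hg : Computes D n f (fun x => ![g x]))
    (hs : Computes D n f (fun x => ![s x])) (hs' : LogSize D n s)
    (hpow : ∀ x, ∃ k, s x = 2 ^ k) : Computes D n f (fun x => ![g x % s x]) := by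
  refine (hg.cons hs).comp (Computes.tmComputes ?_)
  obtain ⟨d, hd⟩ := hs'
  refine Transducer.modPow.computes d (fun x hx => ?_)
  obtain ⟨k, hk⟩ := hpow x
  refine ⟨k, ?_, ?_⟩
  · have h2 := hd x hx
    rw [hk, Nat.size_pow] at h2
    omega
  · have h := Transducer.modPow_emits k ![g x, s x] hk
    rw [hk] at h ⊢
    exact h

/-- Here the second argument may be arbitrarily long; the time is controlled by the digits of `n`
only. -/
lemma computes_clip {f : X → Fin 2 → ℕ} (hf : ∀ x ∈ D, f x 0 = n x) (c : ℕ) :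
    Computes D n f (fun x => ![Transducer.clip (c * (n x).size + c) (f x 1)]) := by
  refine (Transducer.clipper c).computes (2 * c + 2) (fun x hx => ?_)
  obtain ⟨t, ht, h⟩ := Transducer.clipper_emits c (n x).size c (Fin.last c) (f x) rfl
    (by rw [hf x hx])
  refine ⟨t, ht.trans ?_, h⟩
  nlinarith [Transducer.size_le_log (n x)]

lemma Computes.test {σ : Type} [Finite σ] {m : ℕ} {g : X → Fin m → ℕ} (hg : Computes D n f g)
    (hg' : ∀ k, LogSize D n (fun x => g x k)) (δ : σ → (Fin m → Bool) → σ)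
    (acc : σ → Bool) (R : σ → (Fin m → ℕ) → Bool) (s₀ : σ) (h0 : ∀ s, R s (fun _ => 0) = acc s)
    (hR : ∀ s x, R s x = R (δ s (fun k => (x k).bodd)) (fun k => x k / 2)) :
    Computes D n f (fun x => ![(R s₀ (g x)).toNat]) := by
  refine hg.comp (Computes.tmComputes ?_)
  choose c hc using hg'
  refine (Transducer.ofTest δ s₀ acc).computes (∑ k, c k + 1) (fun x hx => ?_)
  obtain ⟨t, ht, h⟩ := Transducer.ofTest_emits (s₀ := s₀) h0 hR
    ((∑ k, c k) * (Nat.log 2 (n x) + 1)) s₀ (g x) (fun k => (hc k x hx).trans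
      (Nat.mul_le_mul_right _ (Finset.single_le_sum (f := c) (fun _ _ => Nat.zero_le _)
        (Finset.mem_univ k))))
  exact ⟨t, ht.trans (by nlinarith [Nat.zero_le (Nat.log 2 (n x))]), h⟩

lemma Computes.eq_test {g h : X → ℕ} (hg : Computes D n f (fun x => ![g x]))
    (hh : Computes D n f (fun x => ![h x])) (hg' : LogSize D n g) (hh' : LogSize D n h) :
    Computes D n f (fun x => ![(decide (g x = h x)).toNat]) := by
  refine ((hg.cons hh).test (Fin.forall_fin_two.2 ⟨hg', hh'⟩)
    (fun (s : Bool) d => s && (d 0 == d 1)) id (fun s x => s && decide (x 0 = x 1)) true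
    (by simp) ?_).congr (by simp)
  intro s x
  cases s with
  | false => simp
  | true =>
    rw [Bool.eq_iff_iff]
    simp only [Bool.true_and, decide_eq_true_eq, Bool.and_eq_true, beq_iff_eq]
    constructor
    · intro h
      simp [h]
    · rintro ⟨h, h'⟩
      rw [eq_bodd_add_two_mul (x 0), eq_bodd_add_two_mul (x 1), h, h']

/-- The automaton keeps a carry `s` with the condition `x 0 ≤ x 1 + x 2 + s`. Removing the lowest
digits and halving replaces `s` by the floor of `(s + d 1 + d 2 - d 0) / 2`, which stays between
`-1` and `1`. -/
lemma Computes.le_add_test {g₁ g₂ g₃ : X → ℕ} (h₁ : Computes D n f (fun x => ![g₁ x]))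
    (h₂ : Computes D n f (fun x => ![g₂ x])) (h₃ : Computes D n f (fun x => ![g₃ x]))
    (h₁' : LogSize D n g₁) (h₂' : LogSize D n g₂) (h₃' : LogSize D n g₃) :
    Computes D n f (fun x => ![(decide (g₁ x ≤ g₂ x + g₃ x)).toNat]) := by
  refine ((h₁.cons (h₂.cons h₃)).test (by intro k; fin_cases k <;> assumption)
    (fun (s : Set.Icc (-1 : ℤ) 1) d =>
      ⟨(s.1 + (d 1).toNat + (d 2).toNat - (d 0).toNat) / 2, ?_⟩)
    (fun s => decide (0 ≤ s.1)) (fun s x => decide ((x 0 : ℤ) ≤ x 1 + x 2 + s.1))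
    ⟨0, by simp⟩ (by simp) ?_).congr ?_
  · obtain ⟨s, h1, h2⟩ := s
    have e0 := Bool.toNat_le (d 0)
    have e1 := Bool.toNat_le (d 1)
    have e2 := Bool.toNat_le (d 2)
    simp only [Set.mem_Icc]
    omega
  · rintro ⟨s, h1, h2⟩ x
    have e0 := eq_bodd_add_two_mul (x 0)
    have e1 := eq_bodd_add_two_mul (x 1)
    have e2 := eq_bodd_add_two_mul (x 2)
    simp only [decide_eq_decide]
    omega
  · intro x _
    simp only [Matrix.cons_val_zero, Matrix.cons_val_one, Matrix.cons_val, add_zero]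
    norm_cast

/-- As for the inequality, with a carry in `{-1, 0, 1}`; but an equation also forces the lowest
digits to match modulo `2`. The state `none` remembers that this has failed. -/
lemma Computes.add_eq_add_test {g₁ g₂ g₃ g₄ : X → ℕ} (h₁ : Computes D n f (fun x => ![g₁ x]))
    (h₂ : Computes D n f (fun x => ![g₂ x])) (h₃ : Computes D n f (fun x => ![g₃ x]))
    (h₄ : Computes D n f (fun x => ![g₄ x]))
    (h₁' : LogSize D n g₁) (h₂' : LogSize D n g₂) (h₃' : LogSize D n g₃) (h₄' : LogSize D n g₄) :
    Computes D n f (fun x => ![(decide (g₁ x + g₂ x = g₃ x + g₄ x)).toNat]) := by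
  let step : Set.Icc (-1 : ℤ) 1 → (Fin 4 → Bool) → ℤ := fun s d =>
    s.1 + (d 0).toNat + (d 1).toNat - (d 2).toNat - (d 3).toNat
  have hstep : ∀ s d, step s d % 2 = 0 → step s d / 2 ∈ Set.Icc (-1 : ℤ) 1 := by
    rintro ⟨s, h1, h2⟩ d
    have e0 := Bool.toNat_le (d 0)
    have e1 := Bool.toNat_le (d 1)
    have e2 := Bool.toNat_le (d 2)
    have e3 := Bool.toNat_le (d 3)
    simp only [Set.mem_Icc, step]
    omega
  refine ((h₁.cons (h₂.cons (h₃.cons h₄))).test (by intro k; fin_cases k <;> assumption)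
    (fun (s : Option (Set.Icc (-1 : ℤ) 1)) d => s.bind fun s =>
      if h : step s d % 2 = 0 then some ⟨step s d / 2, hstep s d h⟩ else none)
    (fun s => s.elim false fun s => decide (s.1 = 0))
    (fun s x => s.elim false fun s => decide ((x 0 : ℤ) + x 1 + s.1 = x 2 + x 3))
    (some ⟨0, by simp⟩) (by rintro (_ | s) <;> simp) ?_).congr ?_
  · rintro (_ | s) x
    · rfl
    · have e0 := eq_bodd_add_two_mul (x 0)
      have e1 := eq_bodd_add_two_mul (x 1)
      have e2 := eq_bodd_add_two_mul (x 2)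
      have e3 := eq_bodd_add_two_mul (x 3)
      simp only [Option.elim_some, Option.bind_some]
      split_ifs with h
      · simp only [Option.elim_some, decide_eq_decide]
        simp only [step] at h ⊢
        omega
      · simp only [Option.elim_none, decide_eq_false_iff_not]
        simp only [step] at h
        omega
  · intro x _
    simp only [Option.elim_some, Matrix.cons_val_zero, Matrix.cons_val_one, Matrix.cons_val,
      add_zero]
    norm_cast

lemma LogSize.const (v : ℕ) : LogSize D n (fun _ => v) :=
  ⟨v.size, fun _ _ => Nat.le_mul_of_pos_right _ (Nat.succ_pos _)⟩

/-- Induction on the number of possible values, testing for the largest one. Both branches of the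
`ite` name the same function, which is computed differently on the two restricted domains. -/
lemma Computes.cases {h : X → ℕ} (hh : Computes D n f (fun x => ![h x])) (m : ℕ)
    (hm : ∀ x ∈ D, h x < m) (g : ℕ → X → Fin b → ℕ)
    (hg : ∀ v < m, Computes {x ∈ D | h x = v} n f (g v)) :
    Computes D n f (fun x => g (h x) x) := by
  induction m generalizing D with
  | zero =>
    -- With no possible value left, `D` is empty and any program will do.
    exact ⟨Empty, inferInstance, ⟨Unit, inferInstance, (), fun _ _ => none⟩, 0,
      fun x hx => absurd (hm x hx) (Nat.not_lt_zero _)⟩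
  | succ m ih =>
    have ht := hh.eq_test (computes_const m)
      ((LogSize.const (m + 1)).of_le (fun x hx => (hm x hx).le)) (LogSize.const m)
    refine (ht.ite (g₀ := fun x => g (h x) x) (g₁ := fun x => g (h x) x) ?_ ?_).congr
      (fun x _ => ite_self _)
    · refine ih (hh.mono fun x hx => hx.1) (fun x hx => ?_) (fun v hv => ?_)
      · have h1 := hm x hx.1
        have h2 : h x ≠ m := by simpa using hx.2
        omega
      · exact (hg v (by omega)).mono fun x hx => ⟨hx.1.1, hx.2⟩
    · refine ((hg m (by omega)).mono fun x hx => ?_).congr (fun x hx => ?_)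
      · exact ⟨hx.1, by simpa using hx.2⟩
      · have : h x = m := by simpa using hx.2
        rw [this]

/-- The remaining output tapes are declared work tapes. -/
lemma Computes.coord {g : X → Fin b → ℕ} (hg : Computes D n f g) (l : Fin b) :
    Computes D n f (fun x => ![g x l]) := by
  obtain ⟨W, hW, P, c, hP⟩ := hg
  let e : Fin a ⊕ Fin b ⊕ W → Fin a ⊕ Fin 1 ⊕ (Fin b ⊕ W)
    | Sum.inl k => Sum.inl k
    | Sum.inr (Sum.inl k) => if k = l then Sum.inr (Sum.inl 0) else Sum.inr (Sum.inr (Sum.inl k))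
    | Sum.inr (Sum.inr w) => Sum.inr (Sum.inr (Sum.inr w))
  have he : Function.Injective e := by
    rintro (x | x | x) (y | y | y) hxy <;> simp only [e] at hxy <;>
      (try split_ifs at hxy) <;> simp_all
  refine ⟨Fin b ⊕ W, inferInstance, P.embed e, c, fun x hx => ?_⟩
  obtain ⟨T, hT, hT1, hT2⟩ := hP x hx
  have key : TapeProg.initTapes (W := Fin 1 ⊕ (Fin b ⊕ W)) (f x) ∘ e =
      TapeProg.initTapes (f x) := by
    funext k
    rcases k with k | k | k
    · rfl
    · simp only [Function.comp_apply, e]; split_ifs <;> rfl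
    · rfl
  rw [← key] at hT
  refine ⟨_, hT.embed he, fun k => ?_, fun k => ?_⟩
  · exact (he.extend_apply T _ (Sum.inl k)).trans (hT1 k)
  · obtain rfl : k = 0 := Subsingleton.elim _ _
    have := (he.extend_apply T (TapeProg.initTapes (f x)) (Sum.inr (Sum.inl l))).trans (hT2 l)
    simpa [e] using this

lemma TMComputes.reindex {Y : Type} {g : X → Fin b → ℕ} (h : TMComputes D n f g) {E : Set Y}
    (φ : Y → X) (hφ : ∀ y ∈ E, φ y ∈ D) :
    TMComputes E (fun y => n (φ y)) (fun y => f (φ y)) (fun y => g (φ y)) := by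
  obtain ⟨M, c, h⟩ := h
  exact ⟨M, c, fun y hy => h _ (hφ y hy)⟩

end Closure

/-! ## Locality of computations -/

/-- The tapes agree on the cells at distance at most `r` from the head. -/
def TapesAgree (r : ℕ) (T T' : Turing.Tape (Option Bool)) : Prop :=
  ∀ i : ℤ, |i| ≤ r → T.nth i = T'.nth i

lemma TapesAgree.head_eq {r : ℕ} {T T' : Turing.Tape (Option Bool)} (h : TapesAgree r T T') :
    T.head = T'.head := by
  simpa using h 0 (by simp)

lemma TapesAgree.act {r : ℕ} {T T' : Turing.Tape (Option Bool)} (h : TapesAgree (r + 1) T T')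
    (s : Option Bool × Option Turing.Dir) :
    TapesAgree r (MultiTapeTM.act T s) (MultiTapeTM.act T' s) := by
  have hw : TapesAgree (r + 1) (T.write s.1) (T'.write s.1) := by
    intro i hi
    rw [Turing.Tape.write_nth, Turing.Tape.write_nth, h i hi]
  obtain ⟨s, d⟩ := s
  intro i hi
  have hi' := abs_le.1 hi
  rcases d with _ | (_ | _)
  · exact hw i (abs_le.2 ⟨by push_cast; omega, by push_cast; omega⟩)
  · simp only [MultiTapeTM.act, Turing.Tape.move_left_nth]
    exact hw _ (abs_le.2 ⟨by push_cast; omega, by push_cast; omega⟩)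
  · simp only [MultiTapeTM.act, Turing.Tape.move_right_nth]
    exact hw _ (abs_le.2 ⟨by push_cast; omega, by push_cast; omega⟩)

namespace TapeProg

variable {K : Type} {P : TapeProg K}

/-- In `t` steps no head gets farther than `t` cells, so the program sees the same symbols and acts
identically on both families of tapes. Tapes equal at the start, such as the blank output tapes, are
therefore equal at the end. -/
lemma Run.of_agree {q : P.State} {T S : K → Turing.Tape (Option Bool)} {t : ℕ}
    (h : P.Run q T S t) : ∀ T', (∀ k, TapesAgree t (T k) (T' k)) →
      ∃ S', P.Run q T' S' t ∧ ∀ k, T k = T' k → S k = S' k := by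
  induction h with
  | @halt q T h =>
    intro T' hT
    refine ⟨T', Run.halt ?_, fun _ hk => hk⟩
    simpa only [(hT _).head_eq] using h
  | @step q T r S t h _ ih =>
    intro T' hT
    obtain ⟨S', h1, h2⟩ := ih (fun k => MultiTapeTM.act (T' k) (r.2 k))
      (fun k => (hT k).act _)
    refine ⟨S', Run.step ?_ h1, fun k hk => h2 k (by simp only [hk])⟩
    simpa only [(hT _).head_eq] using h

lemma Run.unique {q : P.State} {T S : K → Turing.Tape (Option Bool)} {t : ℕ}
    (h : P.Run q T S t) : ∀ {S' t'}, P.Run q T S' t' → S = S' := by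
  induction h with
  | halt h =>
    intro S' t' h'
    cases h' with
    | halt _ => rfl
    | step h1 _ => rw [h] at h1; cases h1
  | step h _ ih =>
    intro S' t' h'
    cases h' with
    | halt h1 => rw [h] at h1; cases h1
    | step h1 h2 =>
      rw [h] at h1
      cases h1
      exact ih h2

end TapeProg

/-- Only the running time on `x` enters: the run on `x` is copied to a run on `y`, and by
determinism it is the run that yields `g y`. -/
lemma TMComputes.exists_agree {X : Type} {a b : ℕ} {D : Set X} {n : X → ℕ} {f : X → Fin a → ℕ}
    {g : X → Fin b → ℕ} (h : TMComputes D n f g) : ∃ c : ℕ, ∀ x ∈ D, ∀ y ∈ D,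
      (∀ l, TapesAgree (c * (Nat.log 2 (n x) + 1)) (MultiTapeTM.numTape (f x l))
        (MultiTapeTM.numTape (f y l))) →
      ∀ l, MultiTapeTM.numTape (g x l) = MultiTapeTM.numTape (g y l) := by
  obtain ⟨W, hW, P, c, h⟩ := h.exists_run
  refine ⟨c, fun x hx y hy hxy l => ?_⟩
  obtain ⟨S, ⟨t, ht, hS⟩, hS2⟩ := h x hx
  obtain ⟨S', ⟨t', -, hS'⟩, hS2'⟩ := h y hy
  obtain ⟨S'', h1, h2⟩ := hS.of_agree (TapeProg.initTapes (f y)) (by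
    rintro (k | k) i hi
    · exact hxy k i (hi.trans (by exact_mod_cast ht))
    · rfl)
  obtain rfl := hS'.unique h1
  rw [← hS2 l, ← hS2' l]
  exact h2 _ rfl

lemma bits_two_pow_mul (B w : ℕ) :
    (2 ^ B * (2 * w + 1)).bits = List.replicate B false ++ true :: w.bits := by
  induction B with
  | zero => simp
  | succ B ih =>
    rw [pow_succ', mul_assoc, Nat.bit0_bits _ (by positivity), ih]
    rfl

lemma tapesAgree_two_pow_mul {B r w w' : ℕ} (hr : r ≤ B) :
    TapesAgree r (MultiTapeTM.numTape (2 ^ B * (2 * w + 1)))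
      (MultiTapeTM.numTape (2 ^ B * (2 * w' + 1))) := by
  intro i hi
  rw [numTape_eq_tapeOf, numTape_eq_tapeOf, bits_two_pow_mul, bits_two_pow_mul]
  rcases i with j | j
  · have hj : j ≤ B := by
      have := (abs_le.1 hi).2
      simp only [Int.ofNat_eq_natCast] at this
      omega
    simp only [tapeOf, Int.ofNat_eq_natCast, Turing.Tape.mk'_nth_nat, Turing.ListBlank.nth_mk]
    simp only [List.getI_eq_getElem?_getD, List.map_append, List.getElem?_append]
    split_ifs with h
    · rfl
    · have : j = B := by simp at h; omega
      subst this
      simp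
  · rfl

/-! ## Polynomial bounds -/

lemma lt_two_pow_log (n : ℕ) : n < 2 ^ (Nat.log 2 n + 1) :=
  Nat.lt_pow_succ_log_self (by norm_num) n

/-- With `polySize_of_le_two_pow`, polynomial size means size at most `2 ^ O(log n)`. This form is
closed under products and matches digit counts and running times. -/
lemma PolySize.exists_le_two_pow {Φ : Type} {G : ℕ → CompGraph Φ} (h : PolySize G) :
    ∃ c : ℕ, ∀ n, (G n).size ≤ 2 ^ (c * (Nat.log 2 n + 1)) := by
  obtain ⟨c, k, h⟩ := h
  refine ⟨c + 1 + k, fun n => (h n).trans ?_⟩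
  have h1 : n ^ k ≤ 2 ^ (k * (Nat.log 2 n + 1)) := by
    rw [mul_comm, pow_mul]
    exact Nat.pow_le_pow_left (lt_two_pow_log n).le k
  have h2 : 2 * c ≤ 2 ^ ((c + 1) * (Nat.log 2 n + 1)) := by
    calc 2 * c ≤ 2 ^ (c + 1) := by rw [pow_succ']; exact Nat.mul_le_mul_left 2 Nat.lt_two_pow_self.le
      _ ≤ _ := Nat.pow_le_pow_right (by norm_num) (Nat.le_mul_of_pos_right _ (Nat.succ_pos _))
  rw [add_mul, pow_add]
  have h3 : 1 ≤ 2 ^ (k * (Nat.log 2 n + 1)) := Nat.one_le_two_pow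
  nlinarith

lemma polySize_of_le_two_pow {Φ : Type} {G : ℕ → CompGraph Φ} {c : ℕ}
    (h : ∀ n, (G n).size ≤ 2 ^ (c * (Nat.log 2 n + 1))) : PolySize G := by
  refine ⟨2 ^ c, c, fun n => (h n).trans ?_⟩
  rcases eq_or_ne n 0 with rfl | hn
  · simp
  · calc 2 ^ (c * (Nat.log 2 n + 1)) = 2 ^ c * (2 ^ Nat.log 2 n) ^ c := by
          rw [← pow_mul, ← pow_add]; congr 1; ring
      _ ≤ 2 ^ c * n ^ c := Nat.mul_le_mul_left _
          (Nat.pow_le_pow_left (Nat.pow_log_le_self 2 hn) c)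
      _ ≤ _ := Nat.le_add_right _ _

lemma PolySize.logSize {Φ : Type} {G : ℕ → CompGraph Φ} (h : PolySize G) {X : Type} {D : Set X}
    {n : X → ℕ} : LogSize D n (fun x => (G (n x)).size) := by
  obtain ⟨c, hc⟩ := h.exists_le_two_pow
  refine ⟨c + 1, fun x _ => Nat.size_le.2 ((hc _).trans_lt ?_)⟩
  exact Nat.pow_lt_pow_right (by norm_num) (by nlinarith)

/-- The node function of a log-uniform family reads only `O(log n)` digits of the node, so that
the graphs have polynomial size. -/
lemma polySize_of_logUniform {q : ℕ} {G : ℕ → CompGraph (Fin q)}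
    (hG : ∀ n i, (G n).node i = none ↔ (G n).size ≤ i) (h : LogUniform typeCode G) :
    PolySize G := by
  obtain ⟨c, hc⟩ := (TMComputes.of_logTimeComputable h.1 (D := Set.univ) (n := fun x => x 0)
    (f := fun x => x) (fun _ _ => ⟨trivial, rfl⟩)).exists_agree
  refine polySize_of_le_two_pow (c := c) fun n => ?_
  by_contra! hlt
  set B := c * (Nat.log 2 n + 1) with hB
  have hbig : (G n).size ≤ 2 ^ B * (2 * (G n).size + 1) := by
    have : 1 ≤ 2 ^ B := Nat.one_le_two_pow
    nlinarith
  -- Both numbers have `B` zeros followed by a one as lowest digits, so within the time bound `B`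
  -- they look alike. Yet the first, `2 ^ B`, is a node and the second is beyond the size.
  have := hc ![n, 2 ^ B * (2 * 0 + 1)] trivial ![n, 2 ^ B * (2 * (G n).size + 1)] trivial (by
    intro l
    fin_cases l
    · exact fun _ _ => rfl
    · exact tapesAgree_two_pow_mul le_rfl) 0
  simp only [Matrix.cons_val_zero, Matrix.cons_val_one] at this
  rw [(hG n _).2 hbig] at this
  cases hn : (G n).node (2 ^ B * (2 * 0 + 1)) with
  | none => rw [hG] at hn; omega
  | some τ =>
    rw [hn] at this
    have h2 : typeCode (some τ) 0 ≠ 0 := by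
      cases τ <;> simp [typeCode]
    have h3 := congrArg Turing.Tape.head this
    have h4 := Transducer.lowDigit_of_ne_zero h2
    rw [Transducer.lowDigit] at h4
    rw [numTape_eq_tapeOf, numTape_eq_tapeOf] at h3
    cases hb : (typeCode (some τ) 0).bits with
    | nil => rw [hb] at h4; cases h4
    | cons b l =>
      rw [hb] at h3
      simp [typeCode, tapeOf] at h3

/-! ## The simulating circuit -/

section Blocks

variable {Φ : Type}

lemma simNode_eq (s : ℕ) (G : CompGraph Φ) (F : NodeType Φ → CompGraph Gate) (i : ℕ) :
    simNode (shiftMap s) G F i =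
      (G.node (i / s)).bind fun τ => ((F τ).node (i % s)).map (blockGate τ) := by
  simp only [simNode, shiftMap, ← Nat.mod_eq_sub_div_mul]
  cases G.node (i / s) <;> rfl

/-- Removes the integer subtractions, leaving comparisons of sums of naturals. The bound `b_j < p`
disappears: `b_i < p` is automatic from `u < s`, and `b_i = b_j`. -/
lemma cross_edge_iff {i j s p e i' j' u w : ℕ} (hi : i' * s + u = i) (hj : j' * s + w = j)
    (hu : u < s) :
    (0 ≤ (i : ℤ) - (((i' * s : ℕ) : ℤ) + s - p) ∧
      (i : ℤ) - (((i' * s : ℕ) : ℤ) + s - p) = (j : ℤ) - (((j' * s : ℕ) : ℤ) + p * e) ∧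
      (j : ℤ) - (((j' * s : ℕ) : ℤ) + p * e) < p) ↔
    s ≤ u + p ∧ u + p * (e + 1) = w + s := by
  subst hi hj
  zify at hu ⊢
  rw [mul_add, mul_one]
  generalize (i' * s : ℤ) = A at *
  generalize (j' * s : ℤ) = B at *
  generalize (p * e : ℤ) = E at *
  omega

lemma simEdge_eq {s : ℕ} (hs : 0 < s) (p : ℕ) (G : CompGraph Φ) (F : NodeType Φ → CompGraph Gate)
    (i j : ℕ) :
    simEdge (shiftMap s) p G F i j =
      if i / s = j / s then (G.node (i / s)).bind fun τ => (F τ).edge (i % s) (j % s)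
      else (G.edge (i / s) (j / s)).bind fun e =>
        if s ≤ i % s + p ∧ i % s + p * (e + 1) = j % s + s then some 0 else none := by
  simp only [simEdge, shiftMap, ← Nat.mod_eq_sub_div_mul]
  split_ifs with h
  · cases G.node (i / s) <;> rfl
  · cases G.edge (i / s) (j / s) with
    | none => rfl
    | some e =>
      simp only [cross_edge_iff (Nat.div_add_mod' i s) (Nat.div_add_mod' j s) (Nat.mod_lt i hs),
        Option.bind_some]

end Blocks

/-! ## Uniformity of the simulating circuit -/

lemma vecCons_eq_of_fin_one (g : Fin 1 → ℕ) : ![g 0] = g := by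
  funext k
  obtain rfl : k = 0 := Subsingleton.elim _ _
  rfl

lemma LogSize.clip {X : Type} {D : Set X} {n : X → ℕ} (c : ℕ) (i : X → ℕ) :
    LogSize D n (fun x => Transducer.clip (c * (n x).size + c) (i x)) := by
  refine ⟨2 * c + 1, fun x _ => Nat.size_le.2 ?_⟩
  have h1 : Transducer.clip (c * (n x).size + c) (i x) < 2 ^ (c * (n x).size + c + 1) := by
    rw [Transducer.clip, pow_succ]
    split_ifs with h
    · omega
    · have := Nat.mod_lt (i x) (show 0 < 2 ^ (c * (n x).size + c) by positivity)
      omega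
  refine h1.trans_le (Nat.pow_le_pow_right (by norm_num) ?_)
  have := Transducer.size_le_log (n x)
  nlinarith [Nat.zero_le (Nat.log 2 (n x))]

/-- Functions of `n` and `i` that vanish at large `i` are computable if they are computable for
numbers `i` with `O(log n)` digits. -/
lemma computes_of_clip {b : ℕ} {F : ℕ → ℕ → Fin b → ℕ} {z : Fin b → ℕ} {c : ℕ}
    (hz : ∀ n i, 2 ^ (c * (Nat.log 2 n + 1)) ≤ i → F n i = z)
    (h : ∀ D : Set (Fin 2 → ℕ), LogSize D (fun x => x 0) (fun x => x 1) →
      Computes D (fun x => x 0) (fun x => x) (fun x => F (x 0) (x 1))) :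
    Computes (Set.univ : Set (Fin 2 → ℕ)) (fun x => x 0) (fun x => x)
      (fun x => F (x 0) (x 1)) := by
  obtain ⟨d, hd⟩ := LogSize.clip (D := (Set.univ : Set (Fin 2 → ℕ))) (n := fun x => x 0) c
    (fun x => x 1)
  -- This set contains all pairs of `n` and a clipped number.
  have h1 := (h {x | (x 1).size ≤ d * (Nat.log 2 (x 0) + 1)} ⟨d, fun x hx => hx⟩).tmComputes
  have h2 : Computes (Set.univ : Set (Fin 2 → ℕ)) (fun x => x 0) (fun x => x)
      (fun x => ![x 0, Transducer.clip (c * (x 0).size + c) (x 1)]) :=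
    (computes_arg 0 logSize_self).cons (computes_clip (fun _ _ => rfl) c)
  refine (h2.comp (h1.reindex
    (fun x : Fin 2 → ℕ => ![x 0, Transducer.clip (c * (x 0).size + c) (x 1)]) (fun x _ => ?_))).congr
    (fun x _ => ?_)
  · exact hd x trivial
  · simp only [Matrix.cons_val_zero, Matrix.cons_val_one]
    by_cases hx : x 1 < 2 ^ (c * (x 0).size + c)
    · rw [Transducer.clip, if_pos hx]
    · have h3 : 2 ^ (c * (Nat.log 2 (x 0) + 1)) ≤ 2 ^ (c * (x 0).size + c) := by
        refine Nat.pow_le_pow_right (by norm_num) ?_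
        have : Nat.log 2 (x 0) ≤ (x 0).size := by
          rcases eq_or_ne (x 0) 0 with h0 | h0
          · simp [h0]
          · exact ((Nat.pow_lt_pow_iff_right (by norm_num)).1
              ((Nat.pow_log_le_self 2 h0).trans_lt (Nat.lt_size_self (x 0)))).le
        nlinarith
      rw [hz _ (x 1) (by omega), hz]
      rw [Transducer.clip, if_neg hx]
      omega

section Simulation

variable {q : ℕ} {p bsize : ℕ → ℕ} {F : NodeType (Fin q) → ℕ → CompGraph Gate}
  {G : ℕ → CompGraph (Fin q)}

/-- The node type with a given code. -/
def typeOfCode {q : ℕ} (v : ℕ) : Option (NodeType (Fin q)) :=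
  if v = 0 then none else if v = 1 then some NodeType.input
  else if h : v - 2 < q then some (NodeType.prim ⟨v - 2, h⟩) else none

lemma typeOfCode_typeCode (τ : Option (NodeType (Fin q))) : typeOfCode (typeCode τ 0) = τ := by
  rcases τ with _ | (_ | f) <;> simp [typeOfCode, typeCode]

lemma typeCode_lt (τ : Option (NodeType (Fin q))) : typeCode τ 0 < q + 2 := by
  rcases τ with _ | (_ | f)
  · simp [typeCode]
  · simp [typeCode]
  · simp [typeCode]

/-- Computation by cases on the type of a node of `G`. -/
lemma computes_by_type {X : Type} {a b : ℕ} {D : Set X} {n : X → ℕ} {f : X → Fin a → ℕ}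
    (hG : LogUniform typeCode G) {i : X → ℕ} (hn : Computes D n f (fun x => ![n x]))
    (hi : Computes D n f (fun x => ![i x]))
    (g : Option (NodeType (Fin q)) → X → Fin b → ℕ)
    (hg : ∀ τ, Computes {x ∈ D | (G (n x)).node (i x) = τ} n f (g τ)) :
    Computes D n f (fun x => g ((G (n x)).node (i x)) x) := by
  have h1 : Computes D n f (fun x => ![typeCode ((G (n x)).node (i x)) 0]) :=
    ((hn.cons hi).comp (TMComputes.of_logTimeComputable hG.1 (fun _ _ => ⟨trivial, rfl⟩))).congr
      (fun x _ => (vecCons_eq_of_fin_one _).symm)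
  refine (h1.cases (q + 2) (fun x _ => typeCode_lt _) (fun v x => g (typeOfCode v) x)
    (fun v _ => ?_)).congr (fun x _ => by rw [typeOfCode_typeCode])
  refine (hg (typeOfCode v)).mono ?_
  rintro x ⟨hx, rfl⟩
  exact ⟨hx, (typeOfCode_typeCode _).symm⟩

/-- On codes, the replacement of input gates is a test of the tag against `1`, with `![3, 1]` coding
`θ_{≥ 1}`. -/
lemma gateCode_blockGate_prim (f : Fin q) (g : Option (NodeType Gate)) :
    gateCode (g.map (blockGate (NodeType.prim f))) =
      if (decide (gateCode g 0 = 1)).toNat = 0 then ![gateCode g 0, gateCode g 1]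
      else ![3, 1] := by
  rcases g with _ | (_ | (Δ | Δ)) <;> simp [gateCode, blockGate]

lemma gateCode_zero_le (g : Option (NodeType Gate)) : gateCode g 0 ≤ 3 := by
  rcases g with _ | (_ | (Δ | Δ)) <;> simp [gateCode]

lemma computes_simNode (hG : LogUniform typeCode G)
    (hF : ∀ τ, LogUniform gateCode (F τ))
    (hpow : ∀ n, ∃ k, bsize n = 2 ^ k)
    (hbsize : LogTimeComputable (a := 0) (b := 1) Set.univ (fun x _ => bsize (x 0)))
    (hbs : ∀ D : Set (Fin 2 → ℕ), LogSize D (fun x => x 0) (fun x => bsize (x 0)))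
    (D : Set (Fin 2 → ℕ)) (hD : LogSize D (fun x => x 0) (fun x => x 1)) :
    Computes D (fun x => x 0) (fun x => x)
      (fun x => gateCode (simNode (shiftMap (bsize (x 0))) (G (x 0)) (fun τ => F τ (x 0))
        (x 1))) := by
  have hn : ∀ D : Set (Fin 2 → ℕ), Computes D (fun x => x 0) (fun x => x) (fun x => ![x 0]) :=
    fun D => computes_arg 0 logSize_self
  have hi : Computes D (fun x => x 0) (fun x => x) (fun x => ![x 1]) := computes_arg 1 hD
  have hb : Computes D (fun x => x 0) (fun x => x) (fun x => ![bsize (x 0)]) :=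
    ((hn D).comp (TMComputes.of_logTimeComputable hbsize (f := fun x : Fin 2 → ℕ => ![x 0])
      (fun _ _ => ⟨trivial, rfl⟩))).congr (fun x _ => (vecCons_eq_of_fin_one fun _ => bsize (x 0)).symm)
  have hlo := hi.mod_pow hb (hbs D) (fun x => hpow _)
  have hdiv := hi.div_pow hb hD (hbs D) (fun x => hpow _)
  have hFn : ∀ τ, Computes D (fun x => x 0) (fun x => x)
      (fun x => gateCode ((F τ (x 0)).node (x 1 % bsize (x 0)))) := fun τ =>
    ((hn D).cons hlo).comp (TMComputes.of_logTimeComputable (hF τ).1 (fun _ _ => ⟨trivial, rfl⟩))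
  refine (computes_by_type hG (hn D) hdiv (fun τ x => gateCode (τ.bind fun τ =>
    ((F τ (x 0)).node (x 1 % bsize (x 0))).map (blockGate τ))) ?_).congr ?_
  · intro τ
    refine Computes.mono ?_ (Set.sep_subset _ _)
    rcases τ with _ | (_ | f)
    · exact (computes_const 0).cons (computes_const 0)
    · refine (hFn NodeType.input).congr (fun x _ => ?_)
      simp only [Option.bind_some]
      have : (blockGate (NodeType.input : NodeType (Fin q))) = id := rfl
      rw [this, Option.map_id_fun, id]
    · refine Computes.congr (((hFn (NodeType.prim f)).coord 0).eq_test (computes_const 1)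
        ((LogSize.const 3).of_le fun x _ => gateCode_zero_le _) (LogSize.const 1) |>.ite
        ((((hFn (NodeType.prim f)).coord 0).cons ((hFn (NodeType.prim f)).coord 1)).mono
          (Set.sep_subset _ _)) ((computes_const 3).cons (computes_const 1))) (fun x _ => ?_)
      simp only [Option.bind_some, gateCode_blockGate_prim]
  · intro x _
    simp only [simNode_eq]

lemma computes_simEdge (hG : LogUniform typeCode G)
    (hF : ∀ τ, LogUniform gateCode (F τ))
    (hpow : ∀ n, ∃ k, bsize n = 2 ^ k)
    (hF_size : ∀ τ n, (F τ n).size = bsize n)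
    (hbsize : LogTimeComputable (a := 0) (b := 1) Set.univ (fun x _ => bsize (x 0)))
    (hp : LogTimeComputable (a := 1) (b := 1) {x | p (x 0) * x 1 ≤ bsize (x 0)}
      (fun x _ => p (x 0) * x 1))
    (hp_le : ∀ n, p n ≤ bsize n)
    (hp_edge : ∀ n, ∀ i < (G n).size, ∀ j < (G n).size, ∀ e, (G n).edge i j = some e →
      p n * (e + 1) ≤ bsize n)
    (D : Set (Fin 3 → ℕ))
    (hbs : LogSize D (fun x => x 0) (fun x => bsize (x 0)))
    (hD₁ : LogSize D (fun x => x 0) (fun x => x 1))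
    (hD₂ : LogSize D (fun x => x 0) (fun x => x 2))
    (hlt : ∀ x ∈ D, x 1 < (G (x 0)).size * bsize (x 0) ∧ x 2 < (G (x 0)).size * bsize (x 0)) :
    Computes D (fun x => x 0) (fun x => x)
      (fun x (_ : Fin 1) => edgeCode (simEdge (shiftMap (bsize (x 0))) (p (x 0)) (G (x 0))
        (fun τ => F τ (x 0)) (x 1) (x 2))) := by
  have hpos : ∀ n, 0 < bsize n := fun n => by
    obtain ⟨k, hk⟩ := hpow n
    rw [hk]; positivity
  have hn : Computes D (fun x => x 0) (fun x => x) (fun x => ![x 0]) := computes_arg 0 logSize_self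
  have hi : Computes D (fun x => x 0) (fun x => x) (fun x => ![x 1]) := computes_arg 1 hD₁
  have hj : Computes D (fun x => x 0) (fun x => x) (fun x => ![x 2]) := computes_arg 2 hD₂
  have hb : Computes D (fun x => x 0) (fun x => x) (fun x => ![bsize (x 0)]) :=
    (hn.comp (TMComputes.of_logTimeComputable hbsize (f := fun x : Fin 3 → ℕ => ![x 0])
      (fun _ _ => ⟨trivial, rfl⟩))).congr (fun x _ => (vecCons_eq_of_fin_one fun _ => bsize (x 0)).symm)
  have hilo := hi.mod_pow hb hbs (fun x => hpow _)
  have hjlo := hj.mod_pow hb hbs (fun x => hpow _)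
  have hidiv := hi.div_pow hb hD₁ hbs (fun x => hpow _)
  have hjdiv := hj.div_pow hb hD₂ hbs (fun x => hpow _)
  have hilo' : LogSize D (fun x => x 0) (fun x => x 1 % bsize (x 0)) :=
    hD₁.of_le fun x _ => Nat.mod_le _ _
  have hjlo' : LogSize D (fun x => x 0) (fun x => x 2 % bsize (x 0)) :=
    hD₂.of_le fun x _ => Nat.mod_le _ _
  have hidiv' : LogSize D (fun x => x 0) (fun x => x 1 / bsize (x 0)) :=
    hD₁.of_le fun x _ => Nat.div_le_self _ _
  have hjdiv' : LogSize D (fun x => x 0) (fun x => x 2 / bsize (x 0)) :=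
    hD₂.of_le fun x _ => Nat.div_le_self _ _
  have hlt' : ∀ x ∈ D, x 1 / bsize (x 0) < (G (x 0)).size ∧ x 2 / bsize (x 0) < (G (x 0)).size :=
    fun x hx => ⟨Nat.div_lt_of_lt_mul (by rw [mul_comm]; exact (hlt x hx).1),
      Nat.div_lt_of_lt_mul (by rw [mul_comm]; exact (hlt x hx).2)⟩
  -- the edges inside a block
  have hin : Computes D (fun x => x 0) (fun x => x)
      (fun x => (fun τ x (_ : Fin 1) => edgeCode (τ.bind fun τ => (F τ (x 0)).edge
        (x 1 % bsize (x 0)) (x 2 % bsize (x 0)))) ((G (x 0)).node (x 1 / bsize (x 0))) x) := by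
    refine computes_by_type hG hn hidiv (fun τ x (_ : Fin 1) => edgeCode (τ.bind fun τ =>
      (F τ (x 0)).edge (x 1 % bsize (x 0)) (x 2 % bsize (x 0)))) ?_
    intro τ
    refine Computes.mono ?_ (Set.sep_subset _ _)
    rcases τ with _ | τ
    · exact (computes_const 0).congr fun x _ => vecCons_eq_of_fin_one fun _ => 0
    · exact (hn.cons (hilo.cons hjlo)).comp (TMComputes.of_logTimeComputable (hF τ).2
        (fun x _ => ⟨⟨by simpa [hF_size] using Nat.mod_lt _ (hpos _),
          by simpa [hF_size] using Nat.mod_lt _ (hpos _)⟩, rfl⟩))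
  -- the edges between different blocks
  have hcode : Computes D (fun x => x 0) (fun x => x)
      (fun x => ![edgeCode ((G (x 0)).edge (x 1 / bsize (x 0)) (x 2 / bsize (x 0)))]) :=
    ((hn.cons (hidiv.cons hjdiv)).comp (TMComputes.of_logTimeComputable hG.2
      (fun x hx => ⟨hlt' x hx, rfl⟩))).congr fun x _ => (vecCons_eq_of_fin_one _).symm
  have hpcode_le : ∀ x ∈ D, p (x 0) * edgeCode ((G (x 0)).edge (x 1 / bsize (x 0))
      (x 2 / bsize (x 0))) ≤ bsize (x 0) := by
    intro x hx
    cases he : (G (x 0)).edge (x 1 / bsize (x 0)) (x 2 / bsize (x 0)) with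
    | none => simp [edgeCode]
    | some e => exact hp_edge _ _ (hlt' x hx).1 _ (hlt' x hx).2 e he
  have hpcode : Computes D (fun x => x 0) (fun x => x)
      (fun x => ![p (x 0) * edgeCode ((G (x 0)).edge (x 1 / bsize (x 0))
        (x 2 / bsize (x 0)))]) :=
    ((hn.cons hcode).comp (TMComputes.of_logTimeComputable hp
      (fun x hx => ⟨hpcode_le x hx, rfl⟩))).congr fun x _ => (vecCons_eq_of_fin_one _).symm
  have hpn : Computes D (fun x => x 0) (fun x => x) (fun x => ![p (x 0)]) :=
    ((hn.cons (computes_const 1)).comp (TMComputes.of_logTimeComputable hp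
      (fun x hx => ⟨by simpa using hp_le (x 0), rfl⟩))).congr fun x _ =>
        ((vecCons_eq_of_fin_one _).symm.trans (by simp))
  have hle := hb.le_add_test hilo hpn hbs hilo' (hbs.of_le fun x _ => hp_le _)
  -- Since `edgeCode` stores `e + 1`, the product computed in `hpcode` is exactly the term `p * (e +
  -- 1)` of `simEdge_eq`. The value `0`, meaning no edge, is sorted out first in `hout`.
  have heq := hilo.add_eq_add_test hpcode hjlo hb hilo' (hbs.of_le hpcode_le) hjlo' hbs
  have hout := hcode.ite (g₀ := fun _ => ![0]) (computes_const 0)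
    ((hle.ite (g₀ := fun _ => ![0]) (computes_const 0)
      ((heq.ite (g₀ := fun _ => ![0]) (computes_const 0) (computes_const 1)).mono
        (Set.sep_subset _ _))).mono (Set.sep_subset _ _))
  refine ((hidiv.eq_test hjdiv hidiv' hjdiv').ite (hout.mono (Set.sep_subset _ _))
    (hin.mono (Set.sep_subset _ _))).congr (fun x hx => ?_)
  rw [← vecCons_eq_of_fin_one fun _ => _]
  simp only [simEdge_eq (hpos _)]
  by_cases h : x 1 / bsize (x 0) = x 2 / bsize (x 0)
  · simp only [h, decide_true, Bool.toNat_true, one_ne_zero, if_false, if_true]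
    rw [← vecCons_eq_of_fin_one fun _ => _]
  · simp only [h, decide_false, Bool.toNat_false, if_true, if_false]
    cases he : (G (x 0)).edge (x 1 / bsize (x 0)) (x 2 / bsize (x 0)) with
    | none => simp [edgeCode]
    | some e =>
      by_cases h1 : bsize (x 0) ≤ x 1 % bsize (x 0) + p (x 0)
      · by_cases h2 : x 1 % bsize (x 0) + p (x 0) * (e + 1) = x 2 % bsize (x 0) + bsize (x 0)
        · simp [h1, h2, edgeCode]
        · simp [h1, h2, edgeCode]
      · simp [h1, edgeCode]

end Simulation

/-! ## Validity of the simulating circuit -/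

namespace CompGraph

variable {Φ : Type} {G : CompGraph Φ}

lemma arity_eq_length (G : CompGraph Φ) (j : ℕ) :
    G.arity j = ((List.range G.size).filter fun i => (G.edge i j).isSome).length := by
  simp only [arity, Finset.card_def, Finset.filter_val, Finset.range_val, Multiset.range,
    Multiset.filter_coe, Multiset.coe_card, Bool.decide_eq_true]

lemma filter_range_eq_singleton {P : ℕ → Bool} {N i₀ : ℕ} (hi : i₀ < N)
    (h : ∀ i < N, P i = true ↔ i = i₀) : (List.range N).filter P = [i₀] := by
  have h1 : (List.range N).filter P = (List.range N).filter (fun i => i == i₀) :=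
    List.filter_congr fun i hi' => by
      rw [Bool.eq_iff_iff, h i (List.mem_range.1 hi'), beq_iff_eq]
  rw [h1, List.filter_beq, List.count_eq_one_of_mem List.nodup_range (List.mem_range.2 hi)]
  rfl

lemma filter_range_mul {P : ℕ → Bool} {S s b : ℕ} (hs : 0 < s) (hb : b < S)
    (h : ∀ i < S * s, P i = true → i / s = b) :
    (List.range (S * s)).filter P =
      ((List.range s).filter fun u => P (b * s + u)).map (b * s + ·) := by
  obtain ⟨d, rfl⟩ := Nat.exists_eq_add_of_lt hb
  rw [show (b + d + 1) * s = b * s + s + d * s by ring] at *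
  rw [List.range_add, List.range_add, List.filter_append, List.filter_append]
  have h1 : (List.range (b * s)).filter P = [] := by
    refine List.filter_eq_nil_iff.2 fun i hi hP => ?_
    have hi' := List.mem_range.1 hi
    have h2 := h i (by omega) hP
    rw [Nat.div_eq_iff hs] at h2
    omega
  have h2 : ((List.range (d * s)).map (b * s + s + ·)).filter P = [] := by
    refine List.filter_eq_nil_iff.2 fun i hi hP => ?_
    obtain ⟨k, hk, rfl⟩ := List.mem_map.1 hi
    have hk' := List.mem_range.1 hk
    have h3 := h _ (by omega) hP
    rw [Nat.div_eq_iff hs] at h3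
    omega
  rw [h1, h2, List.nil_append, List.append_nil, List.filter_map]
  rfl

/-- Argument indices map the sources of `j` injectively into a set of the same cardinality, so every
index occurs. -/
lemma IsValid.exists_arg {k outs : ℕ} {ar : Φ → Option ℕ} (h : G.IsValid k outs ar) {j e : ℕ}
    (hj : j < G.size) (he : e < G.arity j) : ∃ i < G.size, G.edge i j = some e := by
  have hs : ∀ i ∈ (Finset.range G.size).filter (fun i => (G.edge i j).isSome),
      i < G.size ∧ ∃ a, G.edge i j = some a := by
    intro i hi
    rw [Finset.mem_filter, Finset.mem_range] at hi
    exact ⟨hi.1, Option.isSome_iff_exists.1 hi.2⟩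
  have hsurj := Finset.surjOn_of_injOn_of_card_le
    (s := (Finset.range G.size).filter (fun i => (G.edge i j).isSome))
    (t := Finset.range (G.arity j)) (fun i => (G.edge i j).getD 0)
    (by
      intro i hi
      obtain ⟨h1, a, h2⟩ := hs i hi
      simpa [h2] using h.arg_lt i h1 j hj a h2)
    (by
      intro i hi i' hi' hii
      obtain ⟨h1, a, h2⟩ := hs i hi
      obtain ⟨h1', a', h2'⟩ := hs i' hi'
      simp only [h2, h2', Option.getD_some] at hii
      subst hii
      exact h.arg_inj i h1 i' h1' j hj a h2 h2')
    (by rw [Finset.card_range]; exact le_rfl)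
  obtain ⟨i, hi, hie⟩ := hsurj (Finset.mem_coe.2 (Finset.mem_range.2 he))
  obtain ⟨h1, a, h2⟩ := hs i hi
  simp only [h2, Option.getD_some] at hie
  exact ⟨i, h1, by rw [h2, hie]⟩

lemma IsValid.args_getElem {k outs : ℕ} {ar : Φ → Option ℕ} (h : G.IsValid k outs ar) {j : ℕ}
    (hj : j < G.size) : (G.args j).length = G.arity j ∧
      ∀ i < G.size, ∀ e, G.edge i j = some e → (G.args j)[e]? = some i := by
  have hex : ∀ e, ∃ i, e < G.arity j → i < G.size ∧ G.edge i j = some e := fun e => by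
    by_cases he : e < G.arity j
    · obtain ⟨i, hi⟩ := h.exists_arg hj he
      exact ⟨i, fun _ => hi⟩
    · exact ⟨0, fun h => absurd h he⟩
  choose src hsrc using hex
  have hargs : G.args j = (List.range (G.arity j)).map src := by
    rw [args, ← List.flatMap_pure_eq_map]
    refine List.flatMap_congr fun e he => ?_
    obtain ⟨h1, h2⟩ := hsrc e (List.mem_range.1 he)
    refine filter_range_eq_singleton h1 fun i hi => ?_
    rw [decide_eq_true_eq]
    refine ⟨fun h3 => h.arg_inj i hi _ h1 j hj e h3 h2, ?_⟩
    rintro rfl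
    exact h2
  rw [hargs]
  refine ⟨by simp, fun i hi e he => ?_⟩
  have he' := h.arg_lt i hi j hj e he
  obtain ⟨h1, h2⟩ := hsrc e he'
  simp only [List.getElem?_map, List.getElem?_range he', Option.map_some]
  rw [h.arg_inj i hi _ h1 j hj e he h2]

end CompGraph

/-- `G` is a computation graph with `k` inputs, and the circuits `F τ` of size `s` take `A τ` values
of `p` bits in their first gates. -/
structure IsBlockSpec {Φ : Type} (s p k : ℕ) (G : CompGraph Φ) (F : NodeType Φ → CompGraph Gate)
    (A : NodeType Φ → ℕ) : Prop where
  pos : 0 < s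
  size : ∀ τ, (F τ).size = s
  valid_block : ∀ τ, (F τ).IsValid (p * A τ) p (fun _ => none)
  inputs_first : ∀ τ i, (F τ).IsInput i ↔ i < p * A τ
  arity_input : A NodeType.input = 1
  valid : G.IsValid k 1 (fun f => some (A (NodeType.prim f)))

namespace IsBlockSpec

variable {Φ : Type} {s p k : ℕ} {G : CompGraph Φ} {F : NodeType Φ → CompGraph Gate}
  {A : NodeType Φ → ℕ}

lemma p_pos (h : IsBlockSpec s p k G F A) : 0 < p := (h.valid_block NodeType.input).one_le_outs

lemma p_le (h : IsBlockSpec s p k G F A) : p ≤ s := by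
  rw [← h.size NodeType.input]
  exact (h.valid_block NodeType.input).outs_le

lemma div_lt (_ : IsBlockSpec s p k G F A) {i : ℕ} (hi : i < (simCircuit s p G F).size) :
    i / s < G.size :=
  Nat.div_lt_of_lt_mul (by rw [mul_comm]; exact hi)

lemma mul_add_lt {b u : ℕ} (hb : b < G.size) (hu : u < s) :
    b * s + u < (simCircuit s p G F).size := by
  have : (b + 1) * s ≤ G.size * s := Nat.mul_le_mul_right _ hb
  simp only [simCircuit]
  nlinarith

lemma mul_add_div (h : IsBlockSpec s p k G F A) {b u : ℕ} (hu : u < s) : (b * s + u) / s = b := by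
  rw [mul_comm, Nat.mul_add_div h.pos, Nat.div_eq_of_lt hu, add_zero]

lemma mul_add_mod {b u : ℕ} (hu : u < s) : (b * s + u) % s = u := by
  rw [mul_comm, Nat.mul_add_mod, Nat.mod_eq_of_lt hu]

lemma exists_type (h : IsBlockSpec s p k G F A) {b : ℕ} (hb : b < G.size) :
    ∃ τ, G.node b = some τ :=
  Option.ne_none_iff_exists'.1 fun hn => by
    have := (h.valid.node_none b).1 hn
    omega

lemma not_edge_input (h : IsBlockSpec s p k G F A) {τ : NodeType Φ} {u w a : ℕ} (hu : u < s)
    (hw : w < s) (hin : (F τ).IsInput w) : (F τ).edge u w ≠ some a := by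
  intro he
  have h1 := (h.valid_block τ).input_arity w (by rwa [h.size]) hin
  have h2 := (h.valid_block τ).arg_lt u (by rwa [h.size]) w (by rwa [h.size]) a he
  omega

/-- An edge between different blocks leads from an output gate to an input gate. -/
structure IsCross (p s : ℕ) (G : CompGraph Φ) (F : NodeType Φ → CompGraph Gate)
    (A : NodeType Φ → ℕ) (i j e t : ℕ) : Prop where
  ne : i / s ≠ j / s
  edge : G.edge (i / s) (j / s) = some e
  lt : t < p
  source : i % s + p = s + t
  target : j % s = p * e + t
  exists_prim : ∃ f, G.node (j / s) = some (NodeType.prim f) ∧ e < A (NodeType.prim f) ∧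
    (F (NodeType.prim f)).IsInput (j % s)

lemma mul_add_lt_mul {p e t A : ℕ} (ht : t < p) (he : e < A) : p * e + t < p * A := by
  have : p * (e + 1) ≤ p * A := Nat.mul_le_mul_left _ he
  nlinarith

/-- The two kinds of edges enter disjoint sets of gates: input gates of a block circuit have no
edges inside the block, and edges between blocks enter only those gates. -/
lemma edge_cases (h : IsBlockSpec s p k G F A) {i j a : ℕ} (hi : i < (simCircuit s p G F).size)
    (hj : j < (simCircuit s p G F).size) (he : (simCircuit s p G F).edge i j = some a) :
    (i / s = j / s ∧ ∃ τ, G.node (j / s) = some τ ∧ (F τ).edge (i % s) (j % s) = some a ∧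
      ¬ (F τ).IsInput (j % s)) ∨
    (a = 0 ∧ ∃ e t, IsCross p s G F A i j e t) := by
  simp only [simCircuit, simEdge_eq h.pos] at he
  have hi' := h.div_lt hi
  have hj' := h.div_lt hj
  have hmod := Nat.mod_lt i h.pos
  have hmod' := Nat.mod_lt j h.pos
  split_ifs at he with hij
  · left
    rw [hij] at he
    obtain ⟨τ, h1, h2⟩ := Option.bind_eq_some_iff.1 he
    exact ⟨hij, τ, h1, h2, fun hin => h.not_edge_input hmod hmod' hin h2⟩
  · right
    obtain ⟨e, h1, h2⟩ := Option.bind_eq_some_iff.1 he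
    split_ifs at h2 with hc
    obtain ⟨h3, h4⟩ := hc
    rw [mul_add, mul_one] at h4
    have hlt := h.valid.arg_lt _ hi' _ hj' e h1
    refine ⟨by simpa using h2.symm, e, i % s + p - s, hij, h1, by omega, by omega, by omega, ?_⟩
    obtain ⟨τ, hτ⟩ := h.exists_type hj'
    cases τ with
    | input =>
      rw [h.valid.input_arity _ hj' hτ] at hlt
      omega
    | prim f =>
      rw [h.valid.prim_arity _ hj' f _ hτ rfl] at hlt
      refine ⟨f, hτ, hlt, (h.inputs_first _ _).2 ?_⟩
      have := mul_add_lt_mul (p := p) (t := i % s + p - s) (by omega) hlt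
      omega

lemma edge_of_eq (h : IsBlockSpec s p k G F A) {b u w : ℕ} {τ : NodeType Φ}
    (hτ : G.node b = some τ) (hu : u < s) (hw : w < s) :
    (simCircuit s p G F).edge (b * s + u) (b * s + w) = (F τ).edge u w := by
  simp only [simCircuit, simEdge_eq h.pos, h.mul_add_div hu, h.mul_add_div hw, mul_add_mod hu,
    mul_add_mod hw, if_true, hτ, Option.bind_some]

/-- All edges into a non-input gate of a block circuit come from its own block. The predicate `P` is
arbitrary so that arity (`isSome`) and argument lists (`= some a`) are treated together. -/
lemma filter_block (h : IsBlockSpec s p k G F A) {b w : ℕ} {τ : NodeType Φ} (hb : b < G.size)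
    (hτ : G.node b = some τ) (hw : w < s) (hin : ¬ (F τ).IsInput w) (P : Option ℕ → Bool)
    (hP : P none = false) :
    (List.range (simCircuit s p G F).size).filter
        (fun i => P ((simCircuit s p G F).edge i (b * s + w))) =
      ((List.range (F τ).size).filter (fun u => P ((F τ).edge u w))).map (b * s + ·) := by
  have hdiv : ∀ i < G.size * s, P ((simCircuit s p G F).edge i (b * s + w)) = true →
      i / s = b := by
    intro i hi hPi
    cases he : (simCircuit s p G F).edge i (b * s + w) with
    | none => rw [he, hP] at hPi; cases hPi
    | some a =>
      have hc := h.edge_cases hi (mul_add_lt hb hw) he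
      rw [h.mul_add_div hw, mul_add_mod hw] at hc
      rcases hc with hc | ⟨-, e, t, hc⟩
      · exact hc.1
      · obtain ⟨f, h1, -, h2⟩ := hc.exists_prim
        rw [h.mul_add_div hw, hτ] at h1
        rw [mul_add_mod hw] at h2
        cases h1
        exact absurd h2 hin
  have hsz : (simCircuit s p G F).size = G.size * s := rfl
  rw [hsz, CompGraph.filter_range_mul h.pos hb hdiv, h.size]
  congr 1
  refine List.filter_congr fun u hu => ?_
  rw [h.edge_of_eq hτ (List.mem_range.1 hu) hw]

lemma arity_block (h : IsBlockSpec s p k G F A) {b w : ℕ} {τ : NodeType Φ} (hb : b < G.size)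
    (hτ : G.node b = some τ) (hw : w < s) (hin : ¬ (F τ).IsInput w) :
    (simCircuit s p G F).arity (b * s + w) = (F τ).arity w := by
  rw [CompGraph.arity_eq_length, CompGraph.arity_eq_length,
    h.filter_block hb hτ hw hin Option.isSome rfl, List.length_map]

lemma args_block (h : IsBlockSpec s p k G F A) {b w : ℕ} {τ : NodeType Φ} (hb : b < G.size)
    (hτ : G.node b = some τ) (hw : w < s) (hin : ¬ (F τ).IsInput w) :
    (simCircuit s p G F).args (b * s + w) = ((F τ).args w).map (b * s + ·) := by
  rw [CompGraph.args, CompGraph.args, h.arity_block hb hτ hw hin, List.map_flatMap]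
  refine List.flatMap_congr fun a _ => ?_
  exact h.filter_block hb hτ hw hin (fun o => decide (o = some a)) (by simp)

/-- The position `p * e + t` with `t < p` determines `e` and `t`; then `e` determines the source
block and `t` the gate in it. -/
lemma cross_unique (h : IsBlockSpec s p k G F A) {i i' j e t e' t' : ℕ}
    (hi : i < (simCircuit s p G F).size) (hi' : i' < (simCircuit s p G F).size)
    (hj : j < (simCircuit s p G F).size)
    (hc : IsCross p s G F A i j e t) (hc' : IsCross p s G F A i' j e' t') : i = i' := by
  have h1 : p * e + t = p * e' + t' := by rw [← hc.target, ← hc'.target]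
  have he : e = e' := by
    have h2 := congrArg (· / p) h1
    simpa [Nat.mul_add_div h.p_pos, Nat.div_eq_of_lt hc.lt, Nat.div_eq_of_lt hc'.lt] using h2
  subst he
  have h3 := h.valid.arg_inj _ (h.div_lt hi) _ (h.div_lt hi') _ (h.div_lt hj) e hc.edge hc'.edge
  have h4 : i % s = i' % s := by
    have := hc.source
    have := hc'.source
    omega
  rw [← Nat.div_add_mod i s, ← Nat.div_add_mod i' s, h3, h4]

lemma edge_of_cross (h : IsBlockSpec s p k G F A) {i j e t : ℕ}
    (hc : IsCross p s G F A i j e t) : (simCircuit s p G F).edge i j = some 0 := by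
  simp only [simCircuit, simEdge_eq h.pos, if_neg hc.ne, hc.edge, Option.bind_some]
  have := hc.source
  have := hc.target
  rw [if_pos]
  rw [mul_add, mul_one]
  constructor <;> omega

/-- The argument of an IDENTITY gate. -/
lemma exists_cross (h : IsBlockSpec s p k G F A) {b e t : ℕ} {f : Φ} (hb : b < G.size)
    (hf : G.node b = some (NodeType.prim f)) (he : e < A (NodeType.prim f)) (ht : t < p) :
    p * e + t < s ∧ ∃ b' < G.size, G.edge b' b = some e ∧
      IsCross p s G F A (b' * s + (s - p + t)) (b * s + (p * e + t)) e t := by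
  have hin : (F (NodeType.prim f)).IsInput (p * e + t) :=
    (h.inputs_first _ _).2 (mul_add_lt_mul ht he)
  have hlt : p * e + t < s := by
    by_contra hge
    have := ((h.valid_block (NodeType.prim f)).node_none (p * e + t)).2
      (by rw [h.size]; omega)
    rw [CompGraph.IsInput, this] at hin
    cases hin
  obtain ⟨b', hb', hbe⟩ := h.valid.exists_arg hb (by
    rw [h.valid.prim_arity b hb f _ hf rfl]; exact he)
  have hp := h.p_le
  have hu : s - p + t < s := by omega
  refine ⟨hlt, b', hb', hbe, ?_, ?_, ht, ?_, ?_, ?_⟩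
  · rw [h.mul_add_div hu, h.mul_add_div hlt]
    -- Equal blocks would mean a loop of `G` at `b'`.
    rintro rfl
    exact h.valid.acyclic b' (Relation.TransGen.single ⟨hb', hb', by simp [hbe]⟩)
  · rwa [h.mul_add_div hu, h.mul_add_div hlt]
  · rw [mul_add_mod hu]; omega
  · rw [mul_add_mod hlt]
  · rw [h.mul_add_div hlt, mul_add_mod hlt]
    exact ⟨f, hf, he, hin⟩

lemma edge_iff_of_cross (h : IsBlockSpec s p k G F A) {i j e t : ℕ}
    (hi : i < (simCircuit s p G F).size) (hj : j < (simCircuit s p G F).size)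
    (hc : IsCross p s G F A i j e t) {i' : ℕ} (hi' : i' < (simCircuit s p G F).size) {a : ℕ} :
    (simCircuit s p G F).edge i' j = some a ↔ i' = i ∧ a = 0 := by
  constructor
  · intro he
    rcases h.edge_cases hi' hj he with ⟨-, τ, h1, -, h3⟩ | ⟨h1, e', t', hc'⟩
    · obtain ⟨f, h4, -, h5⟩ := hc.exists_prim
      rw [h1] at h4
      cases h4
      exact absurd h5 h3
    · exact ⟨h.cross_unique hi' hi hj hc' hc, h1⟩
  · rintro ⟨rfl, rfl⟩
    exact h.edge_of_cross hc

lemma arity_cross (h : IsBlockSpec s p k G F A) {i j e t : ℕ}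
    (hi : i < (simCircuit s p G F).size) (hj : j < (simCircuit s p G F).size)
    (hc : IsCross p s G F A i j e t) : (simCircuit s p G F).arity j = 1 := by
  rw [CompGraph.arity_eq_length, CompGraph.filter_range_eq_singleton hi]
  · rfl
  · intro i' hi'
    rw [Option.isSome_iff_exists]
    simp only [h.edge_iff_of_cross hi hj hc hi']
    simp

lemma args_cross (h : IsBlockSpec s p k G F A) {i j e t : ℕ}
    (hi : i < (simCircuit s p G F).size) (hj : j < (simCircuit s p G F).size)
    (hc : IsCross p s G F A i j e t) : (simCircuit s p G F).args j = [i] := by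
  rw [CompGraph.args, h.arity_cross hi hj hc, List.range_one, List.flatMap_singleton,
    CompGraph.filter_range_eq_singleton hi]
  intro i' hi'
  rw [decide_eq_true_eq, h.edge_iff_of_cross hi hj hc hi']
  simp

lemma node_eq (b u : ℕ) (h : IsBlockSpec s p k G F A) (hu : u < s) :
    (simCircuit s p G F).node (b * s + u) =
      (G.node b).bind fun τ => ((F τ).node u).map (blockGate τ) := by
  simp only [simCircuit, simNode_eq, h.mul_add_div hu, mul_add_mod hu]

lemma isInput_iff (h : IsBlockSpec s p k G F A) {b u : ℕ} (hu : u < s) :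
    (simCircuit s p G F).IsInput (b * s + u) ↔ G.IsInput b ∧ u < p := by
  have hin := h.inputs_first NodeType.input u
  rw [h.arity_input, mul_one] at hin
  rw [← hin, CompGraph.IsInput, CompGraph.IsInput, CompGraph.IsInput, h.node_eq b u hu]
  rcases G.node b with _ | (_ | f)
  · simp
  · rcases hx : (F NodeType.input).node u with _ | (_ | g) <;> simp [hx, blockGate]
  · rcases hx : (F (NodeType.prim f)).node u with _ | (_ | g) <;> simp [hx, blockGate]

lemma count_block (h : IsBlockSpec s p k G F A) (b : ℕ) {u : ℕ} (hu : u ≤ s) :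
    Nat.count (fun i => (simCircuit s p G F).IsInput (b * s + i)) u =
      if G.IsInput b then min u p else 0 := by
  induction u with
  | zero => simp
  | succ u ih =>
    rw [Nat.count_succ, ih (by omega)]
    simp only [h.isInput_iff (show u < s by omega)]
    by_cases hb : G.IsInput b
    · simp only [hb, if_true, true_and]
      split_ifs <;> omega
    · simp [hb]

/-- Each input node contributes its first `p` gates and no other block contributes any. So bit `u`
of the input at node `b` stands at the right place of the concatenated input. -/
lemma count_input (h : IsBlockSpec s p k G F A) (b : ℕ) {u : ℕ} (hu : u ≤ s) :
    Nat.count (simCircuit s p G F).IsInput (b * s + u) =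
      p * Nat.count G.IsInput b + if G.IsInput b then min u p else 0 := by
  rw [Nat.count_add, h.count_block b hu]
  congr 1
  clear hu
  induction b with
  | zero => simp
  | succ b ih =>
    rw [add_mul, one_mul, Nat.count_add, ih, h.count_block b le_rfl, Nat.count_succ]
    have := h.p_le
    split_ifs
    · rw [mul_add, mul_one, min_eq_right this]
    · simp

lemma node_eq_none (h : IsBlockSpec s p k G F A) (i : ℕ) :
    (simCircuit s p G F).node i = none ↔ (simCircuit s p G F).size ≤ i := by
  have hmod := Nat.mod_lt i h.pos
  rw [← Nat.div_add_mod' i s, h.node_eq _ _ hmod]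
  have hb := h.valid.node_none (i / s)
  constructor
  · intro hn
    by_contra! hlt
    rw [Nat.div_add_mod'] at hlt
    obtain ⟨τ, hτ⟩ := h.exists_type (h.div_lt hlt)
    rw [hτ, Option.bind_some, Option.map_eq_none_iff,
      (h.valid_block τ).node_none, h.size] at hn
    omega
  · intro hle
    rw [Nat.div_add_mod'] at hle
    rw [hb.2 ((Nat.le_div_iff_mul_le h.pos).2 hle), Option.bind_none]

lemma adj_cases (h : IsBlockSpec s p k G F A) {i j : ℕ} (hij : (simCircuit s p G F).Adj i j) :
    (i / s = j / s ∧ ∃ τ, G.node (j / s) = some τ ∧ (F τ).Adj (i % s) (j % s)) ∨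
    (G.Adj (i / s) (j / s) ∧ s ≤ i % s + p ∧
      ∃ τ, G.node (j / s) = some τ ∧ (F τ).IsInput (j % s)) := by
  obtain ⟨hi, hj, hs⟩ := hij
  obtain ⟨a, ha⟩ := Option.isSome_iff_exists.1 hs
  rcases h.edge_cases hi hj ha with ⟨h1, τ, h2, h3, -⟩ | ⟨-, e, t, hc⟩
  · refine Or.inl ⟨h1, τ, h2, ?_, ?_, by simp [h3]⟩ <;> rw [h.size] <;>
      exact Nat.mod_lt _ h.pos
  · obtain ⟨f, h1, -, h2⟩ := hc.exists_prim
    have := hc.source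
    exact Or.inr ⟨⟨h.div_lt hi, h.div_lt hj, by simp [hc.edge]⟩, by omega, _, h1, h2⟩

/-- A path that ever leaves a block projects to a nonempty path of `G`. A cycle would thus give a
cycle in one block circuit or in `G`. -/
lemma transGen_cases (h : IsBlockSpec s p k G F A) {i j : ℕ}
    (hij : Relation.TransGen (simCircuit s p G F).Adj i j) :
    (i / s = j / s ∧ ∃ τ, G.node (j / s) = some τ ∧
      Relation.TransGen (F τ).Adj (i % s) (j % s)) ∨
    Relation.TransGen G.Adj (i / s) (j / s) := by
  induction hij with
  | single hij =>
    rcases h.adj_cases hij with ⟨h1, τ, h2, h3⟩ | ⟨h1, -⟩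
    · exact Or.inl ⟨h1, τ, h2, Relation.TransGen.single h3⟩
    · exact Or.inr (Relation.TransGen.single h1)
  | tail _ hij ih =>
    rcases h.adj_cases hij with ⟨h1, τ, h2, h3⟩ | ⟨h1, -⟩
    · rw [h1] at ih
      rcases ih with ⟨h4, τ', h5, h6⟩ | h4
      · rw [h2] at h5
        cases h5
        exact Or.inl ⟨h4, τ, h2, h6.tail h3⟩
      · exact Or.inr h4
    · rcases ih with ⟨h4, -⟩ | h4
      · rw [h4]
        exact Or.inr (Relation.TransGen.single h1)
      · exact Or.inr (h4.tail h1)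

lemma isValid (h : IsBlockSpec s p k G F A) :
    (simCircuit s p G F).IsValid (p * k) p (fun _ => none) where
  node_none := h.node_eq_none
  one_le_outs := h.p_pos
  outs_le := h.p_le.trans (Nat.le_mul_of_pos_left _ h.valid.outs_le)
  acyclic i hi := by
    rcases h.transGen_cases hi with ⟨-, τ, -, h1⟩ | h1
    · exact (h.valid_block τ).acyclic _ h1
    · exact h.valid.acyclic _ h1
  inputs := by
    have := h.count_input G.size (Nat.zero_le s)
    rw [add_zero, h.valid.inputs] at this
    refine this.trans ?_
    simp
  input_arity j hj hin := by
    have hmod := Nat.mod_lt j h.pos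
    rw [← Nat.div_add_mod' j s, h.isInput_iff hmod] at hin
    rw [CompGraph.arity, Finset.card_eq_zero, Finset.filter_eq_empty_iff]
    intro i hi hs
    obtain ⟨a, ha⟩ := Option.isSome_iff_exists.1 hs
    rcases h.edge_cases (Finset.mem_range.1 hi) hj ha with ⟨-, τ, h1, -, h2⟩ | ⟨-, e, t, hc⟩
    · rw [hin.1] at h1
      cases h1
      rw [h.inputs_first, h.arity_input, mul_one] at h2
      exact h2 hin.2
    · obtain ⟨f, h1, -⟩ := hc.exists_prim
      rw [hin.1] at h1
      cases h1
  prim_arity _ _ _ _ _ h := by cases h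
  arg_lt i hi j hj a he := by
    rcases h.edge_cases hi hj he with ⟨-, τ, h1, h2, h3⟩ | ⟨rfl, e, t, hc⟩
    · have hmod := Nat.mod_lt j h.pos
      have := (h.valid_block τ).arg_lt (i % s) (by rw [h.size]; exact Nat.mod_lt _ h.pos) (j % s)
        (by rw [h.size]; exact hmod) a h2
      rwa [← h.arity_block (h.div_lt hj) h1 hmod h3, Nat.div_add_mod'] at this
    · rw [h.arity_cross hi hj hc]
      exact Nat.one_pos
  arg_inj i hi i' hi' j hj a he he' := by
    rcases h.edge_cases hi hj he with ⟨h0, τ, h1, h2, h3⟩ | ⟨rfl, e, t, hc⟩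
    · rcases h.edge_cases hi' hj he' with ⟨h0', τ', h1', h2', -⟩ | ⟨rfl, e, t, hc⟩
      · rw [h1] at h1'
        cases h1'
        have := (h.valid_block τ).arg_inj (i % s) (by rw [h.size]; exact Nat.mod_lt _ h.pos)
          (i' % s) (by rw [h.size]; exact Nat.mod_lt _ h.pos) (j % s)
          (by rw [h.size]; exact Nat.mod_lt _ h.pos) a h2 h2'
        rw [← Nat.div_add_mod i s, ← Nat.div_add_mod i' s, h0, h0', this]
      · exact ((h.edge_iff_of_cross hi' hj hc hi).1 he).1
    · exact ((h.edge_iff_of_cross hi hj hc hi').1 he').1.symm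

/-! ## Depth -/

/-- Induction from the end of the path. The first segment `i % s :: seg` is counted separately
because it need not yet start at an input gate; every later segment is a complete path through its
block and is charged `D`. -/
lemma exists_split (h : IsBlockSpec s p k G F A) {D : ℕ∞}
    (hD : ∀ τ, (F τ).depth p ≤ D) (l : List ℕ) : ∀ i : ℕ,
    (∀ j ∈ i :: l, j < (simCircuit s p G F).size) →
    (i :: l).IsChain (simCircuit s p G F).Adj →
    (∃ t ∈ (i :: l).getLast?, (simCircuit s p G F).size ≤ t + p) →
    ∃ (τ : NodeType Φ) (seg m : List ℕ), G.node (i / s) = some τ ∧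
      (∀ u ∈ i % s :: seg, u < (F τ).size) ∧ (i % s :: seg).IsChain (F τ).Adj ∧
      (∃ t ∈ (i % s :: seg).getLast?, (F τ).size ≤ t + p) ∧
      (∀ b ∈ i / s :: m, b < G.size) ∧ (i / s :: m).IsChain G.Adj ∧
      (∃ t ∈ (i / s :: m).getLast?, G.size ≤ t + 1) ∧
      ((i :: l).length : ℕ∞) ≤ (i % s :: seg).length + m.length * D := by
  induction l with
  | nil =>
    intro i hi _ hlast
    have hi' := hi i (by simp)
    obtain ⟨τ, hτ⟩ := h.exists_type (h.div_lt hi')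
    have hmod := Nat.mod_lt i h.pos
    have hdm := Nat.div_add_mod' i s
    have hle : G.size * s ≤ i + p := by
      obtain ⟨t, ht, hle⟩ := hlast
      simp only [List.getLast?_singleton, Option.mem_some_iff] at ht
      subst ht
      exact hle
    have hp := h.p_le
    -- As `p ≤ s`, the last `p` gates lie in the last block.
    have hb : G.size ≤ i / s + 1 := by
      by_contra! hlt
      have : (i / s + 1 + 1) * s ≤ G.size * s := Nat.mul_le_mul_right _ hlt
      nlinarith
    have hb' : G.size = i / s + 1 := le_antisymm hb (h.div_lt hi')
    refine ⟨τ, [], [], hτ, by simpa [h.size] using hmod, by simp, ⟨i % s, by simp, ?_⟩,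
      by simpa using h.div_lt hi', by simp, ⟨i / s, by simp, hb⟩, by simp⟩
    rw [h.size]
    rw [hb'] at hle
    nlinarith
  | cons j l ih =>
    intro i hi hchain hlast
    rw [List.isChain_cons_cons] at hchain
    rw [List.getLast?_cons_cons] at hlast
    obtain ⟨τ, seg, m, h1, h2, h3, h4, h5, h6, h7, h8⟩ :=
      ih j (fun u hu => hi u (List.mem_cons_of_mem _ hu)) hchain.2 hlast
    have hlen : ((i :: j :: l).length : ℕ∞) = (j :: l).length + 1 := by
      rw [List.length_cons]; push_cast; rfl
    rw [hlen]
    rcases h.adj_cases hchain.1 with ⟨h9, τ', h10, h11⟩ | ⟨h9, h10, τ', h11, h12⟩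
    · rw [h1] at h10
      cases h10
      refine ⟨τ, j % s :: seg, m, h9 ▸ h1, ?_, List.isChain_cons_cons.2 ⟨h11, h3⟩,
        by rwa [List.getLast?_cons_cons], h9 ▸ h5, h9 ▸ h6, h9 ▸ h7, ?_⟩
      · intro u hu
        rcases List.mem_cons.1 hu with rfl | hu
        · exact h11.1
        · exact h2 u hu
      · calc ((j :: l).length : ℕ∞) + 1 ≤ ((j % s :: seg).length + m.length * D) + 1 := by gcongr
          _ = _ := by
            rw [List.length_cons (a := i % s)]; push_cast; ring
    · rw [h1] at h11
      cases h11
      obtain ⟨τ', hτ'⟩ := h.exists_type (h.div_lt (hi i (by simp)))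
      have hmod := Nat.mod_lt i h.pos
      -- The edge into `j` crosses blocks, so `j % s` is an input gate and this segment is now
      -- complete; gate `i`, an output gate of its block, begins a new one.
      have hio : (F τ).IsIOPath p (j % s :: seg) := ⟨h2, h3, ⟨j % s, by simp, h12⟩, h4⟩
      have hle : ((j % s :: seg).length : ℕ∞) ≤ D :=
        (le_iSup₂ (f := fun (l : List ℕ) (_ : l ∈ {l | (F τ).IsIOPath p l}) => (l.length : ℕ∞))
          _ hio).trans (hD τ)
      refine ⟨τ', [], j / s :: m, hτ', by simpa [h.size] using hmod, by simp,
        ⟨i % s, by simp, by rw [h.size]; exact h10⟩, ?_, List.isChain_cons_cons.2 ⟨h9, h6⟩,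
        by rwa [List.getLast?_cons_cons], ?_⟩
      · intro u hu
        rcases List.mem_cons.1 hu with rfl | hu
        · exact h9.1
        · exact h5 u hu
      · calc ((j :: l).length : ℕ∞) + 1 ≤ (D + m.length * D) + 1 := by
              gcongr
              exact h8.trans (by gcongr)
          _ = _ := by
            rw [List.length_cons (a := j / s), List.length_singleton]; push_cast; ring

/-- For a path that starts at an input gate of the circuit, the first segment is also a complete
path through a block, namely that of an input node, and is bounded by `D` as well. -/
lemma depth_le (h : IsBlockSpec s p k G F A) {D : ℕ∞} (hD : ∀ τ, (F τ).depth p ≤ D) :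
    (simCircuit s p G F).depth p ≤ G.depth 1 * D := by
  refine iSup₂_le fun l hl => ?_
  obtain ⟨h1, h2, ⟨i, hi, hin⟩, h3⟩ := hl
  cases l with
  | nil => cases hi
  | cons i' l =>
    simp only [List.head?_cons, Option.mem_some_iff] at hi
    subst hi
    obtain ⟨τ, seg, m, g1, g2, g3, g4, g5, g6, g7, g8⟩ := h.exists_split hD l i' h1 h2 h3
    have hmod := Nat.mod_lt i' h.pos
    rw [← Nat.div_add_mod' i' s, h.isInput_iff hmod] at hin
    have hτ : τ = NodeType.input := by
      have := hin.1
      rw [CompGraph.IsInput, g1] at this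
      exact Option.some.inj this
    subst hτ
    have hseg : ((i' % s :: seg).length : ℕ∞) ≤ D :=
      (le_iSup₂ (f := fun (l : List ℕ) (_ : l ∈ {l | (F NodeType.input).IsIOPath p l}) =>
        (l.length : ℕ∞)) _ ⟨g2, g3, ⟨i' % s, by simp, by
          rw [h.inputs_first, h.arity_input, mul_one]; exact hin.2⟩, g4⟩).trans (hD _)
    have hm : ((i' / s :: m).length : ℕ∞) ≤ G.depth 1 :=
      le_iSup₂ (f := fun (l : List ℕ) (_ : l ∈ {l | G.IsIOPath 1 l}) => (l.length : ℕ∞)) _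
        ⟨g5, g6, ⟨i' / s, by simp, hin.1⟩, g7⟩
    calc ((i' :: l).length : ℕ∞) ≤ D + m.length * D := g8.trans (by gcongr)
      _ = (i' / s :: m).length * D := by rw [List.length_cons]; push_cast; ring
      _ ≤ _ := by gcongr

end IsBlockSpec

/-! ## The function computed by the simulating circuit -/

lemma bitsOf_cons {p : ℕ} (w : Word p) (x : List (Word p)) :
    bitsOf (w :: x) = List.ofFn w ++ bitsOf x := rfl

lemma bitsOf_length {p : ℕ} (x : List (Word p)) : (bitsOf x).length = p * x.length := by
  induction x with
  | nil => simp [bitsOf]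
  | cons w x ih =>
    rw [bitsOf_cons, List.length_append, ih, List.length_ofFn, List.length_cons]
    ring

lemma bitsOf_getElem? {p : ℕ} (x : List (Word p)) : ∀ (e : ℕ) (t : Fin p),
    (bitsOf x)[p * e + t]? = (x[e]?).map (fun w => w t) := by
  induction x with
  | nil => simp [bitsOf]
  | cons w x ih =>
    intro e t
    rw [bitsOf_cons]
    cases e with
    | zero =>
      rw [mul_zero, zero_add, List.getElem?_append_left (by simp)]
      simp
    | succ e =>
      rw [List.getElem?_append_right (by simp; nlinarith)]
      have : p * (e + 1) + t - (List.ofFn w).length = p * e + t := by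
        rw [List.length_ofFn, mul_add, mul_one]; omega
      rw [this, ih]
      simp

lemma bitsOf_singleton_injective {p : ℕ} {y z : Word p} (h : bitsOf [y] = bitsOf [z]) :
    y = z := by
  simpa [bitsOf] using h

lemma Gate.eval_identity (b : Bool) : (Gate.ge 1).eval [b] = b := by
  cases b <;> rfl

namespace IsBlockSpec

variable {Φ : Type} {s p k : ℕ} {G : CompGraph Φ} {F : NodeType Φ → CompGraph Gate}
  {A : NodeType Φ → ℕ}

lemma count_inputs_block (h : IsBlockSpec s p k G F A) (τ : NodeType Φ) {u : ℕ}
    (hu : u ≤ p * A τ) : Nat.count (F τ).IsInput u = u := by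
  rw [Nat.count_iff_forall]
  intro i hi
  rw [h.inputs_first]
  omega

/-- The values taken by the block of node `b`. -/
def blockInput (G : CompGraph Φ) (v : ℕ → Word p) (b : ℕ) : NodeType Φ → List (Word p)
  | NodeType.input => [v b]
  | NodeType.prim _ => (G.args b).map v

/-- Every block is evaluated on the words that the valuation of `G` assigns to its arguments, and
these block valuations are glued. They fit together because the last `p` gates of block `b` carry
the word of node `b`. -/
lemma outputs_of_outputs (h : IsBlockSpec s p k G F A) {fn : Φ → List (Word p) → Word p}
    (hin : ∀ w : Word p, (F NodeType.input).Outputs Gate.eval p (bitsOf [w]) (bitsOf [w]))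
    (hprim : ∀ f (x : List (Word p)), x.length = A (NodeType.prim f) →
      (F (NodeType.prim f)).Outputs Gate.eval p (bitsOf x) (bitsOf [fn f x]))
    {x : List (Word p)} {y : Word p} (hy : G.Outputs fn 1 x [y]) :
    (simCircuit s p G F).Outputs Gate.eval p (bitsOf x) (bitsOf [y]) := by
  obtain ⟨v, hv, hvy⟩ := hy
  -- The side conditions stand inside the existential so that `choose` yields a single total family
  -- `w`.
  have hblock : ∀ b, ∃ w : ℕ → Bool, ∀ τ, b < G.size → G.node b = some τ →
      (F τ).IsValuation Gate.eval (bitsOf (blockInput G v b τ)) w ∧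
      bitsOf [v b] = (List.range p).map (fun t => w (s - p + t)) := by
    intro b
    by_cases hb : b < G.size
    · obtain ⟨τ, hτ⟩ := h.exists_type hb
      have hout : (F τ).Outputs Gate.eval p (bitsOf (blockInput G v b τ)) (bitsOf [v b]) := by
        cases τ with
        | input => exact hin (v b)
        | prim f =>
          rw [(hv b hb).2 f hτ]
          refine hprim f _ ?_
          rw [blockInput, List.length_map, (h.valid.args_getElem hb).1]
          exact h.valid.prim_arity b hb f _ hτ rfl
      obtain ⟨w, h1, h2⟩ := hout
      rw [h.size] at h2
      refine ⟨w, fun τ' _ hτ' => ?_⟩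
      rw [hτ] at hτ'
      cases hτ'
      exact ⟨h1, h2⟩
    · exact ⟨fun _ => false, fun _ hb' => absurd hb' hb⟩
  choose w hw using hblock
  have hout : ∀ b < G.size, ∀ t : Fin p, w b (s - p + t) = v b t := by
    intro b hb t
    obtain ⟨τ, hτ⟩ := h.exists_type hb
    have h1 := congrArg (fun l : List Bool => l[p * 0 + (t : ℕ)]?) (hw b τ hb hτ).2
    simp only [bitsOf_getElem?] at h1
    simpa [List.getElem?_range t.2] using h1.symm
  have hinp : ∀ b < G.size, ∀ τ, G.node b = some τ → ∀ e (t : Fin p), e < A τ →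
      p * e + t < s → ∃ z, (blockInput G v b τ)[e]? = some z ∧ w b (p * e + t) = z t := by
    intro b hb τ hτ e t he hlt
    have h1 := ((hw b τ hb hτ).1 (p * e + t) (by rwa [h.size])).1
      ((h.inputs_first _ _).2 (mul_add_lt_mul t.2 he))
    rw [h.count_inputs_block τ (mul_add_lt_mul t.2 he).le, bitsOf_getElem?,
      Option.map_eq_some_iff] at h1
    obtain ⟨z, h2, h3⟩ := h1
    exact ⟨z, h2, h3.symm⟩
  have hp := h.p_le
  have hsub : ∀ t : Fin p, s - p + t < s := fun t => by have := t.2; omega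
  refine ⟨fun i => w (i / s) (i % s), fun i hi => ?_, ?_⟩
  · have hmod := Nat.mod_lt i h.pos
    have hb := h.div_lt hi
    obtain ⟨τ, hτ⟩ := h.exists_type hb
    simp only
    generalize hbi : i / s = b at *
    generalize hui : i % s = u at *
    obtain rfl : i = b * s + u := by rw [← hbi, ← hui, Nat.div_add_mod']
    constructor
    · intro hinput
      rw [h.isInput_iff hmod] at hinput
      obtain ⟨h1, hup⟩ := hinput
      obtain rfl : τ = NodeType.input := by
        rw [CompGraph.IsInput, hτ] at h1
        exact Option.some.inj h1
      rw [h.count_input b hmod.le, if_pos h1, min_eq_left hup.le]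
      obtain ⟨z, h2, h3⟩ := hinp b hb _ hτ 0 ⟨u, hup⟩ (by rw [h.arity_input]; exact Nat.one_pos)
        (by simpa using hmod)
      have h4 := bitsOf_getElem? x (Nat.count G.IsInput b) ⟨u, hup⟩
      rw [h4, (hv b hb).1 h1]
      simp only [mul_zero, zero_add] at h3
      rw [h3]
      simp only [blockInput, List.getElem?_cons_zero, Option.some.injEq] at h2
      rw [← h2]
      rfl
    · intro g hg
      rw [h.node_eq b u hmod, hτ, Option.bind_some, Option.map_eq_some_iff] at hg
      obtain ⟨g', hg', hgg⟩ := hg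
      -- A reserved gate of a primitive block is an IDENTITY gate fed by bit `u % p` of argument `u
      -- / p`; any other gate has the arguments it has in its block circuit.
      by_cases hinput : (F τ).IsInput u
      · rw [CompGraph.IsInput, hg'] at hinput
        cases hinput
        cases τ with
        | input => cases hgg
        | prim f =>
          cases hgg
          have hu : u < p * A (NodeType.prim f) := (h.inputs_first _ _).1 hg'
          have hdm := Nat.div_add_mod u p
          have ht := Nat.mod_lt u h.p_pos
          have he : u / p < A (NodeType.prim f) := Nat.div_lt_of_lt_mul hu
          obtain ⟨hlt, b', hb', hedge, hc⟩ := h.exists_cross hb hτ he ht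
          obtain ⟨z, h2, h3⟩ := hinp b hb _ hτ (u / p) ⟨u % p, ht⟩ he hlt
          simp only [hdm] at hc h3
          rw [h.args_cross (mul_add_lt hb' (hsub ⟨u % p, ht⟩)) hi hc, List.map_singleton,
            Gate.eval_identity, h.mul_add_div (hsub ⟨u % p, ht⟩), mul_add_mod (hsub ⟨u % p, ht⟩)]
          have h4 := hout b' hb' ⟨u % p, ht⟩
          simp only at h4
          rw [h3, h4]
          simp only [blockInput, List.getElem?_map,
            (h.valid.args_getElem hb).2 b' hb' _ hedge, Option.map_some, Option.some.injEq] at h2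
          rw [h2]
      · have hgate : (F τ).node u = some (NodeType.prim g) := by
          cases g' with
          | input => exact absurd hg' hinput
          | prim g' =>
            cases τ <;> (cases hgg; exact hg')
        rw [h.args_block hb hτ hmod hinput, List.map_map,
          ((hw b τ hb hτ).1 u (by rwa [h.size])).2 g hgate]
        congr 1
        refine List.map_congr_left fun u' hu' => ?_
        have hadj := (F τ).adj_of_mem_args (by rwa [h.size]) hu'
        have hu'' : u' < s := by
          have := hadj.1
          rwa [h.size] at this
        simp only [Function.comp_apply, h.mul_add_div hu'', mul_add_mod hu'']
  · have hG := h.valid.outs_le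
    have hy : y = v (G.size - 1) := by simpa using hvy
    obtain ⟨τ, hτ⟩ := h.exists_type (show G.size - 1 < G.size by omega)
    rw [hy, (hw (G.size - 1) τ (by omega) hτ).2]
    refine List.map_congr_left fun t ht => ?_
    have hts := hsub ⟨t, List.mem_range.1 ht⟩
    have hidx : (simCircuit s p G F).size - p + t = (G.size - 1) * s + (s - p + t) := by
      simp only [simCircuit]
      obtain ⟨S, hS⟩ : ∃ S, G.size = S + 1 := ⟨G.size - 1, by omega⟩
      rw [hS, add_mul, one_mul, Nat.add_sub_cancel]
      omega
    simp only [hidx, h.mul_add_div hts, mul_add_mod hts]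

/-- For the converse, `G` has some output `z`, which the circuit then also outputs; its output is
unique, and a word is determined by its bits. -/
lemma outputs_iff (h : IsBlockSpec s p k G F A) {fn : Φ → List (Word p) → Word p}
    (hin : ∀ w : Word p, (F NodeType.input).Outputs Gate.eval p (bitsOf [w]) (bitsOf [w]))
    (hprim : ∀ f (x : List (Word p)), x.length = A (NodeType.prim f) →
      (F (NodeType.prim f)).Outputs Gate.eval p (bitsOf x) (bitsOf [fn f x]))
    {x : List (Word p)} (hx : x.length = k) (y : Word p) :
    G.Outputs fn 1 x [y] ↔
      (simCircuit s p G F).Outputs Gate.eval p (bitsOf x) (bitsOf [y]) := by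
  refine ⟨h.outputs_of_outputs hin hprim, fun hy => ?_⟩
  obtain ⟨l, hl, -⟩ := h.valid.existsUnique_outputs fn x hx
  obtain ⟨z, rfl⟩ : ∃ z, l = [z] := by
    obtain ⟨v, -, rfl⟩ := hl
    exact ⟨_, rfl⟩
  have hz := h.outputs_of_outputs hin hprim hl
  have huniq := (h.isValid.existsUnique_outputs Gate.eval (bitsOf x)
    (by rw [bitsOf_length, hx])).unique hy hz
  rwa [bitsOf_singleton_injective huniq]

end IsBlockSpec

/-! ### Uniformity of the family and the final theorem -/

lemma logUniform_simCircuit {q : ℕ} {p bsize : ℕ → ℕ} {F : NodeType (Fin q) → ℕ → CompGraph Gate}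
    {G : ℕ → CompGraph (Fin q)} {A : ℕ → NodeType (Fin q) → ℕ}
    (h : ∀ n, IsBlockSpec (bsize n) (p n) n (G n) (fun τ => F τ n) (A n))
    (hG : LogUniform typeCode G) (hF : ∀ τ, LogUniform gateCode (F τ))
    (hF_poly : PolySize (F NodeType.input))
    (hpoly : PolySize (fun n => simCircuit (bsize n) (p n) (G n) (fun τ => F τ n)))
    (hpow : ∀ n, ∃ k, bsize n = 2 ^ k)
    (hbsize : LogTimeComputable (a := 0) (b := 1) Set.univ (fun x _ => bsize (x 0)))
    (hp : LogTimeComputable (a := 1) (b := 1) {x | p (x 0) * x 1 ≤ bsize (x 0)}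
      (fun x _ => p (x 0) * x 1)) :
    LogUniform gateCode (fun n => simCircuit (bsize n) (p n) (G n) (fun τ => F τ n)) := by
  have hbs : ∀ {a : ℕ} (D : Set (Fin (a + 1) → ℕ)),
      LogSize D (fun x => x 0) (fun x => bsize (x 0)) := fun D => by
    have := hF_poly.logSize (D := D) (n := fun x => x 0)
    simpa only [(h _).size] using this
  constructor
  · obtain ⟨c, hc⟩ := hpoly.exists_le_two_pow
    refine (computes_of_clip (c := c) (z := gateCode none) (F := fun n i =>
      gateCode ((simCircuit (bsize n) (p n) (G n) (fun τ => F τ n)).node i))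
      (fun n i hi => ?_) (fun D hD => ?_)).tmComputes.logTimeComputable
    · rw [((h n).node_eq_none i).2 ((hc n).trans hi)]
    · exact computes_simNode hG hF hpow hbsize hbs D hD
  · refine Computes.tmComputes ?_ |>.logTimeComputable
    refine computes_simEdge hG hF hpow (fun τ n => (h n).size τ) hbsize hp (fun n => (h n).p_le)
      ?_ _ (hbs _) (hpoly.logSize.of_le fun x hx => hx.1.le)
      (hpoly.logSize.of_le fun x hx => hx.2.le) (fun x hx => hx)
    intro n i hi j hj e he
    have hlt := (h n).valid.arg_lt i hi j hj e he
    obtain ⟨τ, hτ⟩ := (h n).exists_type hj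
    cases τ with
    | input =>
      rw [(h n).valid.input_arity j hj hτ] at hlt
      omega
    | prim f =>
      rw [(h n).valid.prim_arity j hj f _ hτ rfl] at hlt
      have hpp := (h n).p_pos
      -- The last gate reserved for argument `e` lies inside the block, which is `p * (e + 1) ≤
      -- bsize`.
      have := ((h n).exists_cross hj hτ hlt (t := p n - 1) (by omega)).1
      rw [mul_add, mul_one]
      omega

theorem corollary3 (q : ℕ) (p bsize : ℕ → ℕ) (arity : Fin q → ℕ → ℕ)
    (fn : (n : ℕ) → Fin q → List (Word (p n)) → Word (p n))
    (F : NodeType (Fin q) → ℕ → CompGraph Gate)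
    (G : ℕ → CompGraph (Fin q))
    (hbsize_pow : ∀ n, ∃ k, bsize n = 2 ^ k)
    (hbsize : LogTimeComputable (a := 0) (b := 1) Set.univ (fun x _ => bsize (x 0)))
    (hp : LogTimeComputable (a := 1) (b := 1) {x | p (x 0) * x 1 ≤ bsize (x 0)}
      (fun x _ => p (x 0) * x 1))
    (hF : SpecifiedBy p arity fn F)
    (hF_size : ∀ τ n, (F τ n).size = bsize n)
    (hG : ∀ n, (G n).IsValid n 1 (fun f => some (arity f n)))
    (hG_uniform : LogUniform typeCode G)
    (hG_depth : ConstantDepth G (fun _ => 1)) :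
    ∃ C : ℕ → CompGraph Gate,
      (∀ n, C n = simCircuit (bsize n) (p n) (G n) (fun τ => F τ n)) ∧
      IsLogUniformTC0 C (fun n => p n * n) p ∧
      (∀ n (x : List (Word (p n))), x.length = n → ∀ y : Word (p n),
        (G n).Outputs (fn n) 1 x [y] ↔ (C n).Outputs Gate.eval (p n) (bitsOf x) (bitsOf [y])) ∧
      (∀ n, (C n).depth (p n) ≤
        (G n).depth 1 * Finset.univ.sup (fun τ => (F τ n).depth (p n))) ∧
      (∀ n, (C n).size ≤ (G n).size * Finset.univ.sup (fun τ => (F τ n).size)) := by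
  have hspec : ∀ n, IsBlockSpec (bsize n) (p n) n (G n) (fun τ => F τ n)
      (fun τ => blockArity arity τ n) := fun n =>
    { pos := by
        obtain ⟨k, hk⟩ := hbsize_pow n
        rw [hk]
        positivity
      size := fun τ => hF_size τ n
      valid_block := fun τ => (hF.tc0 τ).valid n
      inputs_first := fun τ i => hF.inputs_first τ n i
      arity_input := rfl
      valid := hG n }
  have hdepth : ∀ n, (simCircuit (bsize n) (p n) (G n) (fun τ => F τ n)).depth (p n) ≤
      (G n).depth 1 * Finset.univ.sup (fun τ => (F τ n).depth (p n)) := fun n =>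
    (hspec n).depth_le fun τ =>
      Finset.le_sup (f := fun τ => (F τ n).depth (p n)) (Finset.mem_univ τ)
  have hF_poly := (hF.tc0 NodeType.input).polySize
  -- The number of blocks is polynomial by the locality argument, and the block size because it is
  -- the size of a `TC⁰` family.
  have hpoly : PolySize (fun n => simCircuit (bsize n) (p n) (G n) (fun τ => F τ n)) := by
    obtain ⟨c, hc⟩ := (polySize_of_logUniform (fun n => (hG n).node_none)
      hG_uniform).exists_le_two_pow
    obtain ⟨d, hd⟩ := hF_poly.exists_le_two_pow
    refine polySize_of_le_two_pow (c := c + d) fun n => ?_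
    rw [add_mul, pow_add]
    refine Nat.mul_le_mul (hc n) ?_
    rw [← hF_size NodeType.input n]
    exact hd n
  refine ⟨fun n => simCircuit (bsize n) (p n) (G n) (fun τ => F τ n), fun _ => rfl,
    ⟨fun n => (hspec n).isValid, ?_, ?_, hpoly⟩, ?_, hdepth, fun n => ?_⟩
  · exact logUniform_simCircuit hspec hG_uniform (fun τ => (hF.tc0 τ).uniform) hF_poly hpoly
      hbsize_pow hbsize hp
  · obtain ⟨d, hd⟩ := hG_depth
    choose e he using fun τ => (hF.tc0 τ).constDepth
    refine ⟨d * Finset.univ.sup e, fun n => (hdepth n).trans ?_⟩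
    push_cast
    refine mul_le_mul' (hd n) (Finset.sup_le fun τ _ => (he τ n).trans ?_)
    exact_mod_cast Finset.le_sup (f := e) (Finset.mem_univ τ)
  · intro n x hx y
    exact (hspec n).outputs_iff (hF.input n) (fun f => hF.prim f n) hx y
  · refine Nat.mul_le_mul_left _ ?_
    rw [← hF_size NodeType.input n]
    exact Finset.le_sup (f := fun τ => (F τ n).size) (Finset.mem_univ _)
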